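/- Let $\mathbb K$ be $\mathbb R$ or $\mathbb C$, let $n\ge 1$ and $N=\{1,\dots,n\}$. A ratio $\alpha/\beta$ is given by two finite collections $\alpha:\alpha_1,\dots,\alpha_p\subseteq N$ and $\beta:\beta_1,\dots,\beta_q\subseteq N$ with positive real exponents $\eta_1,\dots,\eta_p$ and $\theta_1,\dots,\theta_q$; its value at an $n\times n$ positive definite (PD) matrix $A$ over $\mathbb K$ is $$\frac{\alpha(A)}{\beta(A)}=\frac{\prod_{i}(\det A[\alpha_i])^{\eta_i}}{\prod_{j}(\det A[\beta_j])^{\theta_j}},$$ where $A[S]$ is the principal submatrix of $A$ on the rows and columns in $S$, and $\det A[\emptyset]=1$. The ratio is bounded if it has an upper bound independent of the PD matrix $A$, and homogeneous if $\alpha(D)/\beta(D)=1$ for every PD diagonal matrix $D$. Let $\mathcal B_n$ be the set of bounded ratios and $\mathcal H_n$ the set of homogeneous ratios. The formal logarithm $\log(\alpha/\beta)\in\mathbb R^{2^N}$ has as its entry at each nonempty $T\subseteq N$ the total exponent of $T$ in $\alpha$ minus its total exponent in $\beta$, and its entry at $\emptyset$ is chosen so that all entries sum to $0$. For a matrix $M$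 over $\mathbb K$ with $n$ columns, the nullity type $\operatorname{nul}(M)\in\mathbb R^{2^N}$ has as its entry at $T\subseteq N$ the dimension of the null space of the submatrix of $M$ formed by the columns in $T$ (which is $0$ for $T=\emptyset$). Let $\mathcal D_n$ be the set of those $\alpha/\beta\in\mathcal H_n$ such that $\log(\alpha/\beta)^T\operatorname{nul}(M)\ge 0$ for every matrix $M$ over $\mathbb K$ with $n$ columns. Theorem. Consider all the matrices obtained by permuting the columns of the seven matrices $$M^{\emptyset}=\begin{bmatrix}1&1&1&1\end{bmatrix},\quad M^{\{1\}}=\begin{bmatrix}0&1&1&1\end{bmatrix},\quad M^{\{12\}}=\begin{bmatrix}0&0&1&1\end{bmatrix},$$ $$M_{\{123\}}=\begin{bmatrix}1&0&1&0\\0&1&1&0\\0&0&0&1\end{bmatrix},\quad M_{\{1234\}}=\begin{bmatrix}1&0&0&1\\0&1&0&1\\0&0&1&1\end{bmatrix},\quad M_6=\begin{bmatrix}1&0&1&1\\0&1&1&1\end{bmatrix},\quad M_7=\begin{bmatrix}1&1&1&1\\0&1&2&3\end{bmatrix}.$$ They have exactly $23$ distinct nullity types $\mu_1,\dots,\mu_{23}$.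 Moreover $\mathcal B_4=\mathcal D_4$, and a ratio $\alpha/\beta\in\mathcal H_4$ is bounded if and only if $\log(\alpha/\beta)^T\mu_i\ge 0$ for all $i=1,\dots,23$. -/

import Mathlib

open scoped ComplexOrder

/-- A finite collection `α₁, …, α_p` of index sets with positive real exponents `η₁, …, η_p`. -/
abbrev IndexCollection (n : ℕ) : Type := List (Finset (Fin n) × {η : ℝ // 0 < η})

/-- The principal minor `det A[S]`.  It is a (positive) real number when `A` is positive
definite; the determinant of the empty matrix is `1`. -/
noncomputable def principalMinor {𝕜 : Type*} [RCLike 𝕜] {n : ℕ} (A : Matrix (Fin n) (Fin n) 𝕜)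
    (S : Finset (Fin n)) : ℝ :=
  RCLike.re (A.submatrix (fun i : S => (i : Fin n)) (fun j : S => (j : Fin n))).det

/-- `α(A) = ∏ i, (det A[α_i]) ^ η_i`. -/
noncomputable def IndexCollection.eval {𝕜 : Type*} [RCLike 𝕜] {n : ℕ} (α : IndexCollection n)
    (A : Matrix (Fin n) (Fin n) 𝕜) : ℝ :=
  (α.map fun p => principalMinor A p.1 ^ (p.2 : ℝ)).prod

/-- The total exponent with which the index set `T` occurs in the collection. -/
noncomputable def IndexCollection.exponent {n : ℕ} (α : IndexCollection n)
    (T : Finset (Fin n)) : ℝ :=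
  (α.map fun p => if p.1 = T then (p.2 : ℝ) else 0).sum

/-- A formal ratio `α / β` of products of powers of principal minors of `n × n` matrices. -/
structure MinorRatio (n : ℕ) where
  num : IndexCollection n
  den : IndexCollection n

namespace MinorRatio

/-- The value `α(A) / β(A)`. -/
noncomputable def eval {𝕜 : Type*} [RCLike 𝕜] {n : ℕ} (R : MinorRatio n)
    (A : Matrix (Fin n) (Fin n) 𝕜) : ℝ :=
  R.num.eval A / R.den.eval A

/-- The formal logarithm: the overall exponent (numerator minus denominator) of each nonempty
index set; the entry of the empty set is chosen so that all the entries sum to `0`. -/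
noncomputable def formalLog {n : ℕ} (R : MinorRatio n) (T : Finset (Fin n)) : ℝ :=
  if T = ∅ then
    -∑ S ∈ Finset.univ.filter (fun S : Finset (Fin n) => S.Nonempty),
      (R.num.exponent S - R.den.exponent S)
  else R.num.exponent T - R.den.exponent T

end MinorRatio

/-- Ratios with an upper bound, uniform over all positive definite matrices over `𝕜`. -/
def boundedRatios (𝕜 : Type*) [RCLike 𝕜] (n : ℕ) : Set (MinorRatio n) :=
  {R | ∃ C : ℝ, ∀ A : Matrix (Fin n) (Fin n) 𝕜, A.PosDef → R.eval A ≤ C}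

/-- Ratios with value `1` at every positive definite diagonal matrix. -/
def homogeneousRatios (𝕜 : Type*) [RCLike 𝕜] (n : ℕ) : Set (MinorRatio n) :=
  {R | ∀ A : Matrix (Fin n) (Fin n) 𝕜, A.IsDiag → A.PosDef → R.eval A = 1}

/-- The nullity type of a matrix with `n` columns: its entry at `T` is the dimension of the null
space of the submatrix formed by the columns in `T`. -/
noncomputable def nullityType {𝕜 : Type*} [RCLike 𝕜] {m n : ℕ} (M : Matrix (Fin m) (Fin n) 𝕜)
    (T : Finset (Fin n)) : ℝ :=
  (Module.finrank 𝕜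
    (LinearMap.ker (M.submatrix id (fun j : T => (j : Fin n))).mulVecLin) : ℝ)

/-- The standard inner product on `ℝ ^ (2 ^ N)`. -/
def subsetInner {n : ℕ} (x y : Finset (Fin n) → ℝ) : ℝ := ∑ T : Finset (Fin n), x T * y T

/-- The dual nullity semigroup: homogeneous ratios whose formal logarithm has nonnegative inner
product with the nullity type of every matrix with `n` columns. -/
def dualNullityRatios (𝕜 : Type*) [RCLike 𝕜] (n : ℕ) : Set (MinorRatio n) :=
  {R | R ∈ homogeneousRatios 𝕜 n ∧
    ∀ (m : ℕ) (M : Matrix (Fin m) (Fin n) 𝕜), 0 ≤ subsetInner R.formalLog (nullityType M)}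

/-- The `1 × n` matrix with entry `0` in the columns of `S` and `1` elsewhere. -/
def rowMatrix (𝕜 : Type*) [RCLike 𝕜] {n : ℕ} (S : Finset (Fin n)) :
    Matrix (Fin 1) (Fin n) 𝕜 :=
  Matrix.of fun _ j => if j ∈ S then 0 else 1

/-- `[I | e] ⊕ I`, with `[I | e]` of size `2 × 3` in the first three columns. -/
def circuitMatrix₃ (𝕜 : Type*) [RCLike 𝕜] : Matrix (Fin 3) (Fin 4) 𝕜 :=
  !![1, 0, 1, 0;
     0, 1, 1, 0;
     0, 0, 0, 1]

/-- `[I | e]` of size `3 × 4`. -/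
def circuitMatrix₄ (𝕜 : Type*) [RCLike 𝕜] : Matrix (Fin 3) (Fin 4) 𝕜 :=
  !![1, 0, 0, 1;
     0, 1, 0, 1;
     0, 0, 1, 1]

def matrix₆ (𝕜 : Type*) [RCLike 𝕜] : Matrix (Fin 2) (Fin 4) 𝕜 :=
  !![1, 0, 1, 1;
     0, 1, 1, 1]

def matrix₇ (𝕜 : Type*) [RCLike 𝕜] : Matrix (Fin 2) (Fin 4) 𝕜 :=
  !![1, 1, 1, 1;
     0, 1, 2, 3]

/-- The nullity types of all matrices obtained from `M` by permuting its columns. -/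
def permutedNullityTypes {𝕜 : Type*} [RCLike 𝕜] {m n : ℕ} (M : Matrix (Fin m) (Fin n) 𝕜) :
    Set (Finset (Fin n) → ℝ) :=
  Set.range fun σ : Equiv.Perm (Fin n) => nullityType (M.submatrix id σ)

/-- The distinct nullity types of the column permutations of the seven matrices `M^∅`, `M^{1}`,
`M^{12}`, `M_{123}`, `M_{1234}`, `M₆`, `M₇` (the columns being numbered from `0` here). -/
def listedNullityTypes (𝕜 : Type*) [RCLike 𝕜] : Set (Finset (Fin 4) → ℝ) :=
  permutedNullityTypes (rowMatrix 𝕜 (∅ : Finset (Fin 4))) ∪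
  permutedNullityTypes (rowMatrix 𝕜 ({0} : Finset (Fin 4))) ∪
  permutedNullityTypes (rowMatrix 𝕜 ({0, 1} : Finset (Fin 4))) ∪
  permutedNullityTypes (circuitMatrix₃ 𝕜) ∪
  permutedNullityTypes (circuitMatrix₄ 𝕜) ∪
  permutedNullityTypes (matrix₆ 𝕜) ∪
  permutedNullityTypes (matrix₇ 𝕜)

/-! Necessity. Rescaling one diagonal entry of the identity shows that a bounded ratio is
homogeneous. For any `M`, the minor on `T` of the positive definite matrix `Mᴴ * M + t` vanishes, as
`t → 0+`, to an order equal to the nullity of the columns in `T`. Hence the logarithm of the ratio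
divided by `log t` tends to the pairing of the formal logarithm with the nullity type. As `log t →
-∞`, an upper bound on the ratio makes this limit nonnegative.

Sufficiency. Write `x` for the formal logarithm and `h` for the logarithms of the principal minors
of `A`. Homogeneity and zero total leave eleven coordinates: the sums `v S` of `x` over the
supersets of `S`, for `S` with at least two elements. By Möbius inversion the logarithm of the ratio
is the sum of `v S * moebius h S` (`pairing_upperSums`). In these coordinates eleven of the 23
conditions say `v ≥ 0`, and the other twelve are the entries of `inequalities`. The polyhedral cone
so defined is generated, up to permutations of the indices, by eight rays; this is established by a
certified run of the double description method (`mem_cone_permutedRays`).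

It remains to bound the pairing on each ray. Two properties of `h` suffice: Koteljanskii's
inequality, and an exchange inequality that holds up to the constant `log 4`
(`principalMinor_exchange`). Each ray needs Koteljanskii's inequality and at most one exchange
(`LogMinorLike.rayFamilies_le`). Only the listed nullity types enter this direction, so the dual of
all nullity types is already the set of bounded ratios. -/

open scoped NNReal

/-! ### Cutting a finitely generated cone by a half space -/

/-- One step of the double description method: the half space `0 ≤ f` cuts the cone generated by `s`
in the cone generated by the generators on which `f` is nonnegative, and by the nonnegative
combinations in the kernel of `f` of a positive and a negative generator. -/
theorem mem_of_mem_span_of_nonneg {E : Type*} [AddCommGroup E] [Module ℝ E] {s : Set E}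
    (f : E →ₗ[ℝ] ℝ) (C : Submodule ℝ≥0 E) (hpos : ∀ a ∈ s, 0 ≤ f a → a ∈ C)
    (hcomb : ∀ a ∈ s, ∀ b ∈ s, 0 < f a → f b < 0 → f a • b - f b • a ∈ C)
    {x : E} (hx : x ∈ Submodule.span ℝ≥0 s) (hfx : 0 ≤ f x) : x ∈ C := by
  have smulC : ∀ (c : ℝ) (_ : 0 ≤ c) (y : E), y ∈ C → c • y ∈ C := fun c hc y hy =>
    C.smul_mem (⟨c, hc⟩ : ℝ≥0) hy
  set P : Set E := {a ∈ s | 0 ≤ f a} with hP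
  set N : Set E := {a ∈ s | f a < 0} with hN
  have hs : s = P ∪ N := by
    ext a
    simp only [hP, hN, Set.mem_union, Set.mem_ofPred_eq, ← and_or_left]
    exact ⟨fun h => ⟨h, le_or_gt _ _⟩, fun h => h.1⟩
  rw [hs, Submodule.span_union, Submodule.mem_sup] at hx
  obtain ⟨a, ha, b, hb, rfl⟩ := hx
  have haC : ∀ a ∈ Submodule.span ℝ≥0 P, a ∈ C ∧ 0 ≤ f a := by
    intro a ha
    induction ha using Submodule.span_induction with
    | mem a ha => exact ⟨hpos a ha.1 ha.2, ha.2⟩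
    | zero => simp
    | add a b _ _ ha hb => exact ⟨add_mem ha.1 hb.1, by rw [map_add]; exact add_nonneg ha.2 hb.2⟩
    | smul c a _ ha =>
      refine ⟨C.smul_mem c ha.1, ?_⟩
      rw [NNReal.smul_def, map_smul]
      exact mul_nonneg c.2 ha.2
  -- The span contains `0`, so strict negativity needs this exception.
  have hbN : ∀ b ∈ Submodule.span ℝ≥0 N, b = 0 ∨ f b < 0 := by
    intro b hb
    induction hb using Submodule.span_induction with
    | mem b hb => exact Or.inr hb.2
    | zero => simp
    | add a b _ _ ha hb =>
      rcases ha with rfl | ha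
      · simpa using hb
      · rcases hb with rfl | hb
        · simpa using Or.inr ha
        · exact Or.inr (by rw [map_add]; exact add_neg ha hb)
    | smul c b _ hb =>
      rcases hb with rfl | hb
      · simp
      · rcases eq_or_ne c 0 with rfl | hc
        · simp
        · refine Or.inr ?_
          rw [NNReal.smul_def, map_smul]
          exact mul_neg_of_pos_of_neg (by exact_mod_cast pos_iff_ne_zero.2 hc) hb
  -- The expression is bilinear in `a` and `b`, so it is enough to treat pairs of generators.
  have bilinear : ∀ a ∈ Submodule.span ℝ≥0 P, ∀ b ∈ Submodule.span ℝ≥0 N,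
      f a • b - f b • a ∈ C := by
    intro a ha b hb
    induction hb using Submodule.span_induction with
    | mem b hb =>
      induction ha using Submodule.span_induction with
      | mem a ha =>
        rcases ha.2.lt_or_eq with h | h
        · exact hcomb a ha.1 b hb.1 h hb.2
        · rw [← h, zero_smul, zero_sub, ← neg_smul]
          exact smulC _ (by linarith [hb.2]) _ (hpos a ha.1 ha.2)
      | zero => simp
      | add a a' _ _ ha ha' =>
        convert add_mem ha ha' using 1
        rw [map_add]
        module
      | smul c a _ ha =>
        convert C.smul_mem c ha using 1
        simp only [NNReal.smul_def, map_smul, smul_eq_mul]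
        module
    | zero => simp
    | add b b' _ _ hb hb' =>
      convert add_mem hb hb' using 1
      rw [map_add]
      module
    | smul c b _ hb =>
      convert C.smul_mem c hb using 1
      simp only [NNReal.smul_def, map_smul, smul_eq_mul]
      module
  obtain ⟨haC, hfa⟩ := haC a ha
  rcases hbN b hb with rfl | hfb
  · simpa using haC
  · rw [map_add] at hfx
    have hfa' : 0 < f a := by linarith
    -- Split `a + b` into its multiple of `a`, which carries the whole value of `f`, and a part in
    -- the kernel of `f`; both coefficients are nonnegative.
    have : a + b = ((f a + f b) / f a) • a + (1 / f a) • (f a • b - f b • a) := by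
      have h1 : (f a + f b) / f a = 1 + f b / f a := by field_simp
      rw [h1, smul_sub, smul_smul, smul_smul, one_div_mul_cancel hfa'.ne', add_smul, one_smul, one_smul,
        div_eq_mul_one_div (f b), mul_comm (f b)]
      abel
    rw [this]
    exact add_mem (smulC _ (by positivity) _ haC) (smulC _ (by positivity) _ (bilinear a ha b hb))

/-! ### Certified computation of the generators of the cone -/

namespace MinorCone

/-- The real vector whose coordinates are listed in `l`. -/
def vec (l : List ℕ) : ℕ → ℝ := fun i => (l.getD i 0 : ℝ)

/-- The coordinates of `a • x + b • y`. -/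
def comb (a b : ℕ) : List ℕ → List ℕ → List ℕ
  | [], y => y.map (b * ·)
  | x :: xs, [] => a * x :: comb a b xs []
  | x :: xs, y :: ys => (a * x + b * y) :: comb a b xs ys

theorem vec_comb (a b : ℕ) (x y : List ℕ) :
    vec (comb a b x y) = (a : ℝ) • vec x + (b : ℝ) • vec y := by
  induction x generalizing y with
  | nil =>
    funext i
    simp only [vec, comb, List.getD_nil, Pi.add_apply, Pi.smul_apply, smul_eq_mul]
    rcases lt_or_ge i y.length with h | h <;> simp [h]
  | cons x xs ih =>
    funext i
    rcases y with _ | ⟨y, ys⟩ <;> rcases i with _ | i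
    · simp [vec, comb]
    · simpa [vec, comb] using congrFun (ih []) i
    · simp [vec, comb]
    · simpa [vec, comb] using congrFun (ih ys) i

/-- A linear inequality: the sum of the coordinates at the positions in the second list is at most
the sum of those at the positions in the first list. -/
abbrev Inequality : Type := List ℕ × List ℕ

/-- The difference of the two sides of the inequality. -/
noncomputable def Inequality.toLinear (f : Inequality) : (ℕ → ℝ) →ₗ[ℝ] ℝ :=
  (f.1.map fun i => LinearMap.proj (R := ℝ) (φ := fun _ : ℕ => ℝ) i).sum -
    (f.2.map fun i => LinearMap.proj (R := ℝ) (φ := fun _ : ℕ => ℝ) i).sum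

theorem Inequality.toLinear_apply (f : Inequality) (v : ℕ → ℝ) :
    f.toLinear v = (f.1.map v).sum - (f.2.map v).sum := by
  have h : ∀ l : List ℕ, (l.map fun i => LinearMap.proj (R := ℝ) (φ := fun _ : ℕ => ℝ) i).sum v =
      (l.map v).sum := by
    intro l
    induction l with
    | nil => simp
    | cons i l ih => simp [ih]
  rw [toLinear, LinearMap.sub_apply, h, h]

/-- The coordinates of a vector, with codes that serve to find nonnegative combinations: digits in
base `2 ^ 16` of the coordinates and of the two sides of the inequalities, and the bits of the
support. -/
structure Ray where
  coords : List ℕ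
  pos : ℕ
  neg : ℕ
  supp : ℕ

def Ray.side (l : List ℕ) (r : Ray) : ℕ := (l.map fun i => r.coords.getD i 0).sum

/-- Subtraction is truncated, so `excess` and `defect` are the positive and negative parts of the
value of `f` at the ray. -/
def Ray.excess (f : Inequality) (r : Ray) : ℕ := r.side f.1 - r.side f.2

def Ray.defect (f : Inequality) (r : Ray) : ℕ := r.side f.2 - r.side f.1

theorem Ray.toLinear_vec (f : Inequality) (r : Ray) :
    f.toLinear (vec r.coords) = (r.side f.1 : ℝ) - r.side f.2 := by
  simp only [Inequality.toLinear_apply, side, Nat.cast_list_sum, List.map_map]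
  rfl

/-- The combination of `r` and `s` on which equality holds in `f`. -/
def Ray.meet (f : Inequality) (r s : Ray) : Ray :=
  let a := r.excess f
  let b := s.defect f
  ⟨comb b a r.coords s.coords, b * r.pos + a * s.pos, b * r.neg + a * s.neg, Nat.lor r.supp s.supp⟩

/-- The vectors of `L` that are subtracted successively, each time the first one for which no digit
under the mask `g` becomes negative; `G` is the mask of all digits. -/
def decompose (G g : ℕ) (L : List Ray) : ℕ → ℕ → ℕ → List (List ℕ)
  | 0, _, _ => []
  | n + 1, u, v =>
    match L.find? (fun r => Nat.beq (Nat.land (u + r.neg + G - (v + r.pos)) g) g) with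
    | none => []
    | some r => r.coords :: decompose G g L n (u + r.neg) (v + r.pos)

def listSum (l : List (List ℕ)) : List ℕ := l.foldr (comb 1 1) []

/-- The top bit of each of `k` digits in base `2 ^ 16`. When it is added before a digitwise
subtraction of small digits, no borrow crosses a digit, and the bit survives exactly where the
difference is nonnegative. -/
def guardBits (k : ℕ) : ℕ := (2 ^ (16 * k) - 1) / (2 ^ 16 - 1) * 2 ^ 15

def listBeq : List ℕ → List ℕ → Bool
  | [], [] => true
  | x :: xs, y :: ys => Nat.beq x y && listBeq xs ys
  | _, _ => false

/-- The vectors of `L` that satisfy the `i`-th inequality `f`, and those combinations that lie over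
adjacent pairs of vectors of `L`. -/
def refine (i : ℕ) (f : Inequality) (L C : List Ray) : List Ray :=
  ((L.filter fun r => Nat.beq (r.defect f) 0).map fun r =>
    ⟨r.coords, r.pos, r.neg, if Nat.beq (r.excess f) 0 then r.supp else Nat.lor r.supp (2 ^ i)⟩) ++
  C.filter fun c => Nat.beq (L.countP fun r => Nat.beq (Nat.land r.supp c.supp) r.supp) 2

/-- Imposes the inequalities one by one on the cone generated by `L`, and checks that the final
generators are among `M`. -/
def verify (M : List (List ℕ)) (G : ℕ) : ℕ → List Inequality → List Ray → Bool
  | _, [], L => L.all fun r => M.any (listBeq r.coords)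
  | i, f :: fs, L =>
    let C := (L.filter fun r => !Nat.beq (r.excess f) 0).flatMap fun r =>
      (L.filter fun r => !Nat.beq (r.defect f) 0).map (Ray.meet f r)
    let L' := refine i f L C
    C.all (fun c => listBeq (listSum (decompose G (guardBits (i + 1)) L' 16 c.pos c.neg)) c.coords) &&
      verify M G (i + 1) fs L'

theorem eq_of_listBeq {x y : List ℕ} (h : listBeq x y = true) : x = y := by
  induction x generalizing y with
  | nil => cases y <;> simp_all [listBeq]
  | cons x xs ih =>
    cases y with
    | nil => simp [listBeq] at h
    | cons y ys =>
      simp only [listBeq, Bool.and_eq_true] at h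
      rw [Nat.eq_of_beq_eq_true h.1, ih h.2]

theorem natBeq_zero {n : ℕ} (h : n ≠ 0) : Nat.beq n 0 = false :=
  Bool.eq_false_iff.2 fun h' => h (Nat.eq_of_beq_eq_true h')

/-- The cone generated by the vectors of `L`. -/
noncomputable def cone (L : List (List ℕ)) : Submodule ℝ≥0 (ℕ → ℝ) :=
  Submodule.span ℝ≥0 {v | ∃ l ∈ L, vec l = v}

theorem vec_mem_cone {L : List (List ℕ)} {l : List ℕ} (h : l ∈ L) : vec l ∈ cone L :=
  Submodule.subset_span ⟨l, h, rfl⟩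

theorem vec_listSum_mem {C : Submodule ℝ≥0 (ℕ → ℝ)} {l : List (List ℕ)}
    (h : ∀ x ∈ l, vec x ∈ C) : vec (listSum l) ∈ C := by
  induction l with
  | nil =>
    have : vec (listSum []) = 0 := by
      funext i
      simp [listSum, vec]
    rw [this]
    exact zero_mem _
  | cons x l ih =>
    have : vec (listSum (x :: l)) = vec x + vec (listSum l) := by
      change vec (comb 1 1 x (listSum l)) = _
      simp [vec_comb]
    rw [this]
    exact add_mem (h x (by simp)) (ih fun y hy => h y (by simp [hy]))

theorem mem_of_mem_decompose {G g : ℕ} {L : List Ray} {n u v : ℕ} {x : List ℕ}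
    (hx : x ∈ decompose G g L n u v) : x ∈ L.map Ray.coords := by
  induction n generalizing u v with
  | zero => simp [decompose] at hx
  | succ n ih =>
    rw [decompose] at hx
    split at hx
    · simp at hx
    · rename_i r hr
      rcases List.mem_cons.1 hx with rfl | hx
      · exact List.mem_map_of_mem (List.mem_of_find?_eq_some hr)
      · exact ih hx

/-- Soundness does not rest on the codes `pos`, `neg`, `supp` or on the adjacency test: these only
guide the search. What is used is that every combination of a positive and a negative generator is
checked, coordinate by coordinate, to be a sum of retained generators. -/
theorem mem_cone_of_verify {M : List (List ℕ)} {G i : ℕ} {fs : List Inequality} {L : List Ray}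
    (h : verify M G i fs L = true) {v : ℕ → ℝ} (hv : v ∈ cone (L.map Ray.coords))
    (hfs : ∀ f ∈ fs, 0 ≤ f.toLinear v) : v ∈ cone M := by
  induction fs generalizing i L with
  | nil =>
    refine Submodule.span_mono ?_ hv
    rintro _ ⟨l, hl, rfl⟩
    obtain ⟨r, hr, rfl⟩ := List.mem_map.1 hl
    simp only [verify, List.all_eq_true, List.any_eq_true] at h
    obtain ⟨m, hm, hrm⟩ := h r hr
    exact ⟨m, hm, by rw [eq_of_listBeq hrm]⟩
  | cons f fs ih =>
    rw [verify] at h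
    simp only [Bool.and_eq_true] at h
    refine ih h.2 ?_ fun g hg => hfs g (List.mem_cons_of_mem _ hg)
    refine mem_of_mem_span_of_nonneg f.toLinear _ ?_ ?_ hv (hfs f List.mem_cons_self)
    · rintro _ ⟨l, hl, rfl⟩ hfl
      obtain ⟨r, hr, rfl⟩ := List.mem_map.1 hl
      refine vec_mem_cone ?_
      rw [Ray.toLinear_vec, sub_nonneg, Nat.cast_le] at hfl
      simp only [refine, List.map_append, List.map_map, List.mem_append, List.mem_map, List.mem_filter]
      exact Or.inl ⟨r, ⟨hr, by simp [Ray.defect, Nat.sub_eq_zero_of_le hfl]⟩, rfl⟩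
    · rintro _ ⟨l, hl, rfl⟩ _ ⟨l', hl', rfl⟩ hfl hfl'
      obtain ⟨r, hr, rfl⟩ := List.mem_map.1 hl
      obtain ⟨s, hs, rfl⟩ := List.mem_map.1 hl'
      rw [Ray.toLinear_vec] at hfl hfl'
      have hr0 : r.side f.2 < r.side f.1 := by
        exact_mod_cast sub_pos.1 hfl
      have hs0 : s.side f.1 < s.side f.2 := by
        exact_mod_cast sub_neg.1 hfl'
      have key : vec (r.meet f s).coords =
          f.toLinear (vec r.coords) • vec s.coords - f.toLinear (vec s.coords) • vec r.coords := by
        rw [Ray.meet, vec_comb, Ray.toLinear_vec, Ray.toLinear_vec, Ray.excess, Ray.defect,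
          Nat.cast_sub hr0.le, Nat.cast_sub hs0.le]
        module
      rw [← key]
      have := List.all_eq_true.1 h.1 (r.meet f s) (List.mem_flatMap.2 ⟨r, List.mem_filter.2 ⟨hr, by
        simp [Ray.excess, natBeq_zero (Nat.sub_ne_zero_of_lt hr0)]⟩, List.mem_map.2 ⟨s, List.mem_filter.2 ⟨hs, by
        simp [Ray.defect, natBeq_zero (Nat.sub_ne_zero_of_lt hs0)]⟩, rfl⟩⟩)
      rw [← eq_of_listBeq this]
      exact vec_listSum_mem fun x hx => vec_mem_cone (mem_of_mem_decompose hx)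

/-- The `i`-th coordinate is the number of occurrences of `i` in `l`. -/
def indicator (l : List ℕ) : List ℕ := (List.range 16).map fun i => l.count i

/-- The binary code of a list of elements of `{0, 1, 2, 3}`. -/
def code (l : List (Fin 4)) : ℕ := (l.map fun i : Fin 4 => 2 ^ (i : ℕ)).sum

/-- The binary codes of the subsets of `{0, 1, 2, 3}` with at least two elements. -/
def largeCodes : List ℕ := [3, 5, 9, 6, 10, 12, 14, 13, 11, 7, 15]

/-- The inequalities of the cone besides nonnegativity of the coordinates. -/
def inequalities : List Inequality :=
  [([3, 14, 13], [15]), ([5, 14, 11], [15]), ([9, 14, 7], [15]), ([6, 13, 11], [15]),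
   ([10, 13, 7], [15]), ([12, 11, 7], [15]), ([14, 13, 11, 7], [15, 15]),
   ([6, 10, 12], [14]), ([5, 9, 12], [13]), ([3, 9, 10], [11]), ([3, 5, 6], [7]),
   ([3, 5, 9, 6, 10, 12, 15], [14, 13, 11, 7])]

/-- The coordinate rays. -/
def coordinateRays : List Ray :=
  largeCodes.map fun i =>
    ⟨indicator [i],
      2 ^ (16 * i) + 2 ^ 256 * Nat.ofDigits (2 ^ 16) (inequalities.map fun f => f.1.count i),
      2 ^ 256 * Nat.ofDigits (2 ^ 16) (inequalities.map fun f => f.2.count i), 2 ^ i⟩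

/-- The extreme rays of the cone, up to permutations; each is given by the list of the sets that
carry its coordinates. -/
def rayFamilies (i j k l : Fin 4) : List (List (List (Fin 4))) :=
  [[[i, j]],
   [[i, j], [i, j, k]],
   [[k, l], [j, k, l], [i, k, l], [i, j, k, l]],
   [[i, j], [k, l], [i, j, l], [i, j, k]],
   [[i, j], [i, k], [j, k], [i, j, k], [i, j, k], [i, j, k], [i, j, k, l]],
   [[j, k], [j, l], [k, l], [i, k, l], [i, j, l], [i, j, k], [i, j, k, l]],
   [[j, k], [j, l], [k, l], [j, k, l], [j, k, l], [i, j, k, l]],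
   [[j, k], [j, l], [k, l], [j, k, l], [i, k, l], [i, j, l], [i, j, k], [i, j, k, l], [i, j, k, l]]]

def permutedRays : List (List ℕ) :=
  (List.finRange 4).flatMap fun i => (List.finRange 4).flatMap fun j => (List.finRange 4).flatMap fun k =>
    (List.finRange 4).flatMap fun l =>
      if [i, j, k, l].Nodup then (rayFamilies i j k l).map fun r => indicator (r.map code) else []

-- The index starts at `16` because digits `0` to `15` encode coordinates; with the twelve
-- inequalities there are `28` digits.
set_option maxRecDepth 100000 in
theorem verify_inequalities :
    verify permutedRays (guardBits 28) 16 inequalities coordinateRays = true := by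
  decide +kernel
theorem eq_sum_vec_indicator {v : ℕ → ℝ} (hv : ∀ i, i ∉ largeCodes → v i = 0) :
    v = (largeCodes.map fun i => v i • vec (indicator [i])).sum := by
  have h16 : ∀ i, 16 ≤ i → v i = 0 := fun i hi => hv i fun h => by
    revert hi
    simp only [largeCodes, List.mem_cons, List.not_mem_nil, or_false] at h
    omega
  have vec16 : ∀ i j, 16 ≤ i → vec (indicator [j]) i = 0 := fun i j hi => by
    simp [vec, indicator, hi]
  funext i
  rcases lt_or_ge i 16 with hi | hi
  · simp only [largeCodes, List.map_cons, List.map_nil, List.sum_cons, List.sum_nil, Pi.add_apply,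
      Pi.smul_apply, smul_eq_mul, Pi.zero_apply]
    have hcoord : ∀ j, vec (indicator [j]) i = if j = i then 1 else 0 := fun j => by
      simp [vec, indicator, hi, List.count_singleton]
    simp only [hcoord]
    interval_cases i <;> simp <;> exact hv _ (by decide)
  · simp only [largeCodes, List.map_cons, List.map_nil, List.sum_cons, List.sum_nil, Pi.add_apply,
      Pi.smul_apply, smul_eq_mul, Pi.zero_apply, h16 i hi, vec16 i _ hi, mul_zero, add_zero]

/-- The cone cut out by the inequalities is generated by the extreme rays. -/
theorem mem_cone_permutedRays {v : ℕ → ℝ} (hv : ∀ i, i ∉ largeCodes → v i = 0)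
    (hnonneg : ∀ i ∈ largeCodes, 0 ≤ v i) (hineq : ∀ f ∈ inequalities, 0 ≤ f.toLinear v) :
    v ∈ cone permutedRays := by
  refine mem_cone_of_verify verify_inequalities ?_ hineq
  rw [eq_sum_vec_indicator hv]
  refine list_sum_mem fun x hx => ?_
  obtain ⟨i, hi, rfl⟩ := List.mem_map.1 hx
  refine (cone _).smul_mem (⟨v i, hnonneg i hi⟩ : ℝ≥0) (vec_mem_cone ?_)
  simp only [coordinateRays, List.map_map, List.mem_map]
  exact ⟨i, hi, rfl⟩

end MinorCone

/-! ### Schur complements at a diagonal entry -/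

namespace Matrix

variable {𝕜 : Type*} [RCLike 𝕜] {n : ℕ}

/-- The Schur complement of the entry `(k, k)` of `A`, with an additional entry `1` at `(k, k)`. -/
noncomputable def schurAt (A : Matrix (Fin n) (Fin n) 𝕜) (k : Fin n) : Matrix (Fin n) (Fin n) 𝕜 :=
  of fun i j => A i j - A i k * A k j / A k k + if i = k ∧ j = k then 1 else 0

/-- The Schur determinant formula for the block `{k}`. Since `k ∉ S`, the entry `1` added at `(k,
k)` is not seen. -/
theorem det_submatrix_insert (A : Matrix (Fin n) (Fin n) 𝕜) {k : Fin n} {S : Finset (Fin n)}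
    (hk : k ∉ S) (h : A k k ≠ 0) :
    (A.submatrix (fun i : (insert k S : Finset (Fin n)) => (i : Fin n))
      fun j : (insert k S : Finset (Fin n)) => (j : Fin n)).det =
      A k k * ((A.schurAt k).submatrix (fun i : S => (i : Fin n)) fun j : S => (j : Fin n)).det := by
  let e : Unit ⊕ S ≃ (insert k S : Finset (Fin n)) :=
    ((Finset.subtypeInsertEquivOption hk).trans ((Equiv.optionEquivSumPUnit S).trans
      (Equiv.sumComm _ _))).symm
  have he1 : ∀ u, ((e (Sum.inl u) : (insert k S : Finset (Fin n))) : Fin n) = k := fun u => rfl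
  have he2 : ∀ i : S, ((e (Sum.inr i) : (insert k S : Finset (Fin n))) : Fin n) = i := fun u => rfl
  let P : Matrix Unit Unit 𝕜 := of fun _ _ => A k k
  let : Invertible P := ⟨of fun _ _ => (A k k)⁻¹, by ext; simp [P, mul_apply, h],
    by ext; simp [P, mul_apply, h]⟩
  have hblocks : (A.submatrix (fun i : (insert k S : Finset (Fin n)) => (i : Fin n))
      fun j : (insert k S : Finset (Fin n)) => (j : Fin n)).submatrix e e = fromBlocks P (of fun _ (j : S) => A k j) (of fun (i : S) _ => A i k)
        (A.submatrix (fun i : S => (i : Fin n)) fun j : S => (j : Fin n)) := by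
    ext i j
    rcases i with i | i <;> rcases j with j | j <;> simp [he1, he2, P]
  rw [← det_submatrix_equiv_self e, hblocks, det_fromBlocks₁₁]
  congr 1
  · simp [P]
  · congr 1
    ext i j
    have hik : (i : Fin n) ≠ k := fun h' => hk (h' ▸ i.2)
    have : (⅟P) = of fun _ _ => (A k k)⁻¹ := rfl
    simp [this, schurAt, hik, mul_apply]
    ring

/-- The Schur complement is `Pᴴ * A * P`, where `P` projects along the `k`-th basis vector. This
form degenerates only on the kernel of `P`, the line of that vector, where the added entry `1` is
positive. Keeping the index set `Fin n` lets inductions iterate the construction. -/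
theorem PosDef.schurAt {A : Matrix (Fin n) (Fin n) 𝕜} (hA : A.PosDef) (k : Fin n) :
    (A.schurAt k).PosDef := by
  have hkk : A k k ≠ 0 := (hA.diag_pos (i := k)).ne'
  have hAh : ∀ i j, star (A i j) = A j i := fun i j => hA.isHermitian.apply j i
  let P : Matrix (Fin n) (Fin n) 𝕜 := of fun i j =>
    (if i = j then 1 else 0) - if i = k then A k j / A k k else 0
  have hB : A.schurAt k = Pᴴ * A * P + single k k 1 := by
    have hAP : A * P = of fun i j => A i j - A i k * A k j / A k k := by
      ext i j
      simp [P, mul_apply, mul_sub, Finset.sum_sub_distrib, mul_div_assoc]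
    rw [Matrix.mul_assoc, hAP]
    ext i j
    have hstar : ∀ x, star (P x i) = (if x = i then 1 else 0) - if x = k then A i k / A k k else 0 := by
      intro x
      simp only [P, of_apply, star_sub, apply_ite star, star_one, star_zero, star_div₀, hAh]
    simp only [Matrix.schurAt, of_apply, add_apply, mul_apply, conjTranspose_apply, hstar, sub_mul,
      Finset.sum_sub_distrib, ite_mul, one_mul, zero_mul, Finset.sum_ite_eq', Finset.mem_univ, if_true,
      single_apply]
    rw [mul_div_cancel_left₀ _ hkk, sub_self, mul_zero, sub_zero]
    simp only [eq_comm]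
  rw [hB]
  have h1 : (Pᴴ * A * P).PosSemidef := hA.posSemidef.conjTranspose_mul_mul_same P
  have hs : (single k k (1 : 𝕜)).IsHermitian := by
    simp [IsHermitian, conjTranspose_single]
  refine PosDef.of_dotProduct_mulVec_pos (h1.isHermitian.add hs) fun x hx => ?_
  rw [add_mulVec, dotProduct_add]
  have h2 : star x ⬝ᵥ single k k (1 : 𝕜) *ᵥ x = star (x k) * x k := by
    simp [dotProduct, mulVec, single_apply, ite_and]
  have h3 : star x ⬝ᵥ (Pᴴ * A * P) *ᵥ x = star (P *ᵥ x) ⬝ᵥ A *ᵥ (P *ᵥ x) := by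
    rw [star_mulVec, ← mulVec_mulVec, ← mulVec_mulVec, dotProduct_mulVec]
  rw [h2, h3]
  by_cases hP : P *ᵥ x = 0
  · have hxk : x k ≠ 0 := by
      intro hxk
      refine hx (funext fun i => ?_)
      rcases eq_or_ne i k with rfl | hik
      · exact hxk
      · simpa [P, mulVec, dotProduct, hik] using congrFun hP i
    rw [hP]
    simp only [star_zero, zero_dotProduct, zero_add]
    exact (star_mul_self_nonneg (x k)).lt_of_ne' (mul_ne_zero (star_ne_zero.2 hxk) hxk)
  · exact add_pos_of_pos_of_nonneg (hA.dotProduct_mulVec_pos hP) (star_mul_self_nonneg _)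

end Matrix

open Matrix

/-! ### Inequalities between principal minors -/

section PrincipalMinors

variable {𝕜 : Type*} [RCLike 𝕜] {n : ℕ} {A : Matrix (Fin n) (Fin n) 𝕜}

theorem Matrix.PosDef.principalMinor_pos (hA : A.PosDef) (S : Finset (Fin n)) :
    0 < principalMinor A S :=
  (RCLike.pos_iff.1 (hA.submatrix Subtype.val_injective).det_pos).1

theorem Matrix.PosDef.ofReal_re_diag (hA : A.PosDef) (k : Fin n) : ((RCLike.re (A k k) : ℝ) : 𝕜) = A k k :=
  hA.isHermitian.coe_re_apply_self k

theorem principalMinor_singleton (A : Matrix (Fin n) (Fin n) 𝕜) (k : Fin n) :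
    principalMinor A {k} = RCLike.re (A k k) := by
  simp [principalMinor, det_unique]

theorem principalMinor_empty (A : Matrix (Fin n) (Fin n) 𝕜) : principalMinor A ∅ = 1 := by
  simp [principalMinor]

theorem Matrix.PosDef.principalMinor_insert (hA : A.PosDef) {k : Fin n} {S : Finset (Fin n)}
    (hk : k ∉ S) :
    principalMinor A (insert k S) = principalMinor A {k} * principalMinor (A.schurAt k) S := by
  rw [principalMinor_singleton, principalMinor, det_submatrix_insert A hk hA.diag_pos.ne',
    ← hA.ofReal_re_diag k, RCLike.re_ofReal_mul, RCLike.ofReal_re]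
  rfl

theorem Matrix.PosDef.schurAt_diag (hA : A.PosDef) {i j : Fin n} (hij : i ≠ j) :
    principalMinor (A.schurAt i) {j} =
      principalMinor A {j} - ‖A i j‖ ^ 2 / principalMinor A {i} := by
  have : A j i = star (A i j) := (hA.isHermitian.apply j i).symm
  rw [principalMinor_singleton, principalMinor_singleton, principalMinor_singleton, Matrix.schurAt, of_apply,
    this, ← hA.ofReal_re_diag i]
  simp only [hij.symm, false_and, if_false, add_zero, map_sub, RCLike.star_def, RCLike.conj_mul]
  norm_cast

theorem Matrix.PosDef.principalMinor_pair (hA : A.PosDef) {i j : Fin n} (hij : i ≠ j) :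
    principalMinor A {i, j} = principalMinor A {i} * principalMinor A {j} - ‖A i j‖ ^ 2 := by
  rw [hA.principalMinor_insert (by simpa using hij), hA.schurAt_diag hij]
  have := (hA.principalMinor_pos {i}).ne'
  field_simp

/-- Koteljanskii's inequality for sets that differ in one element. -/
theorem Matrix.PosDef.principalMinor_koteljanskii (hA : A.PosDef) {i j : Fin n} (hij : i ≠ j)
    {K : Finset (Fin n)} (hi : i ∉ K) (hj : j ∉ K) :
    principalMinor A (insert i (insert j K)) * principalMinor A K ≤
      principalMinor A (insert i K) * principalMinor A (insert j K) := by
  induction K using Finset.induction_on generalizing A with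
  | empty =>
    simp only [insert_empty_eq, principalMinor_empty, mul_one, hA.principalMinor_pair hij]
    linarith [sq_nonneg ‖A i j‖]
  | insert k K hk ih =>
    -- Every set involved contains `k`, so each minor is `A k k` times a minor of the Schur
    -- complement at `k`, and both sides acquire the same factor, its square.
    simp only [Finset.mem_insert, not_or] at hi hj
    have h := ih (hA.schurAt k) hi.2 hj.2
    have hki : k ≠ i := Ne.symm hi.1
    have hkj : k ≠ j := Ne.symm hj.1
    rw [Finset.insert_comm j k, Finset.insert_comm i k, Finset.insert_comm i k,
      hA.principalMinor_insert hk, hA.principalMinor_insert (by simp only [Finset.mem_insert]; tauto),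
      hA.principalMinor_insert (by simp only [Finset.mem_insert]; tauto),
      hA.principalMinor_insert (by simp only [Finset.mem_insert]; tauto)]
    have := mul_le_mul_of_nonneg_left h (sq_nonneg (principalMinor A {k}))
    nlinarith

/-- Let `β`, `γ`, `ζ` be the diagonal entries and the absolute value of the off-diagonal entry at
`j`, `k` of the Schur complement at `i`, and write `A j j = β + p`, `A k k = γ + q`, `z = ‖A j k‖`.
After division by `A i i` the claim becomes `p q - z² ≤ 3 β γ + β q + γ p`. It follows from `√(p q)
≤ z + ζ` and `ζ² < β γ`. -/
theorem Matrix.PosDef.principalMinor_exchange_pair (hA : A.PosDef) {i j k : Fin n} (hij : i ≠ j)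
    (hik : i ≠ k) (hjk : j ≠ k) :
    principalMinor A {i} * principalMinor A {j, k} ≤
      2 * (principalMinor A {i, j} * principalMinor A {k} +
        principalMinor A {i, k} * principalMinor A {j}) := by
  have hB := hA.schurAt i
  rw [hA.principalMinor_pair hjk, hA.principalMinor_insert (by simpa using hij),
    hA.principalMinor_insert (by simpa using hik)]
  have hbc := hB.principalMinor_pos {j, k}
  rw [hB.principalMinor_pair hjk] at hbc
  have hβ := hA.schurAt_diag hij
  have hγ := hA.schurAt_diag hik
  have hβ0 := hB.principalMinor_pos {j}
  have hγ0 := hB.principalMinor_pos {k}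
  have ha := hA.principalMinor_pos {i}
  have hz : ‖A i j‖ * ‖A i k‖ / principalMinor A {i} ≤ ‖A j k‖ + ‖A.schurAt i j k‖ := by
    have hji : ‖A j i‖ = ‖A i j‖ := by rw [← hA.isHermitian.apply j i, norm_star]
    have h1 : A j i * A i k / A i i = A j k - A.schurAt i j k := by
      simp [Matrix.schurAt, hij.symm]
    have h2 : ‖A i i‖ = principalMinor A {i} := by
      rw [principalMinor_singleton] at ha ⊢
      rw [← hA.ofReal_re_diag i, RCLike.norm_ofReal, RCLike.ofReal_re, abs_of_pos ha]
    rw [← hji, ← h2, ← norm_mul, ← norm_div, h1]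
    exact norm_sub_le _ _
  have hx := norm_nonneg (A i j)
  have hy := norm_nonneg (A i k)
  have hζ := norm_nonneg (A.schurAt i j k)
  have hpq : ‖A i j‖ ^ 2 / principalMinor A {i} * (‖A i k‖ ^ 2 / principalMinor A {i}) =
      (‖A i j‖ * ‖A i k‖ / principalMinor A {i}) ^ 2 := by ring
  have hp : 0 ≤ ‖A i j‖ ^ 2 / principalMinor A {i} := by positivity
  have hq : 0 ≤ ‖A i k‖ ^ 2 / principalMinor A {i} := by positivity
  have ht : 0 ≤ ‖A i j‖ * ‖A i k‖ / principalMinor A {i} := by positivity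
  have hz0 := norm_nonneg (A j k)
  have key : principalMinor A {j} * principalMinor A {k} - ‖A j k‖ ^ 2 ≤
      2 * (principalMinor (A.schurAt i) {j} * principalMinor A {k} +
        principalMinor (A.schurAt i) {k} * principalMinor A {j}) := by
    rw [eq_sub_iff_add_eq] at hβ hγ
    rw [← hβ, ← hγ]
    generalize principalMinor (A.schurAt i) {j} = β at *
    generalize principalMinor (A.schurAt i) {k} = γ at *
    generalize ‖A i j‖ ^ 2 / principalMinor A {i} = p at *
    generalize ‖A i k‖ ^ 2 / principalMinor A {i} = q at *
    generalize ‖A i j‖ * ‖A i k‖ / principalMinor A {i} = t at *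
    generalize ‖A.schurAt i j k‖ = ζ at *
    generalize ‖A j k‖ = z at *
    have h1 : 0 ≤ β * q := by positivity
    have h2 : 0 ≤ γ * p := by positivity
    have h3 : 0 < β * γ := by positivity
    -- If `t ≤ ζ`, then `p q = t² ≤ ζ² < β γ`. Otherwise `z ≥ t - ζ ≥ 0` gives `p q - z² ≤ 2 t ζ`,
    -- and the latter is bounded by the inequality between arithmetic and geometric means.
    rcases le_total t ζ with h | h
    · nlinarith
    · have h4 : 2 * t * ζ ≤ β * q + γ * p := by
        refine abs_le_of_sq_le_sq' ?_ (by positivity) |>.2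
        have : t ^ 2 * ζ ^ 2 ≤ p * q * (β * γ) := by
          rw [hpq]
          exact mul_le_mul_of_nonneg_left (by linarith) (sq_nonneg t)
        nlinarith [sq_nonneg (β * q - γ * p)]
      have h5 : (t - ζ) ^ 2 ≤ z ^ 2 := pow_le_pow_left₀ (by linarith) (by linarith) 2
      nlinarith
  have := mul_le_mul_of_nonneg_left key ha.le
  nlinarith

/-- An approximate triangle inequality: `det A[i] det A[jk]` is at most twice the sum of the
two expressions obtained by exchanging `i` with `j` or `k`. -/
theorem Matrix.PosDef.principalMinor_exchange (hA : A.PosDef) {i j k : Fin n} (hij : i ≠ j)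
    (hik : i ≠ k) (hjk : j ≠ k) {K : Finset (Fin n)} (hi : i ∉ K) (hj : j ∉ K) (hk : k ∉ K) :
    principalMinor A (insert i K) * principalMinor A (insert j (insert k K)) ≤
      2 * (principalMinor A (insert i (insert j K)) * principalMinor A (insert k K) +
        principalMinor A (insert i (insert k K)) * principalMinor A (insert j K)) := by
  induction K using Finset.induction_on generalizing A with
  | empty =>
    simp only [insert_empty_eq]
    exact hA.principalMinor_exchange_pair hij hik hjk
  | insert l K hl ih =>
    simp only [Finset.mem_insert, not_or] at hi hj hk
    have h := ih (hA.schurAt l) hi.2 hj.2 hk.2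
    have hli : l ≠ i := Ne.symm hi.1
    have hlj : l ≠ j := Ne.symm hj.1
    have hlk : l ≠ k := Ne.symm hk.1
    simp only [Finset.insert_comm _ l K, Finset.insert_comm _ l (insert _ K)]
    rw [hA.principalMinor_insert (by simp only [Finset.mem_insert]; tauto), hA.principalMinor_insert (by simp only [Finset.mem_insert]; tauto),
      hA.principalMinor_insert (by simp only [Finset.mem_insert]; tauto), hA.principalMinor_insert (by simp only [Finset.mem_insert]; tauto),
      hA.principalMinor_insert (by simp only [Finset.mem_insert]; tauto),
      hA.principalMinor_insert (by simp only [Finset.mem_insert]; tauto)]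
    have := mul_le_mul_of_nonneg_left h (sq_nonneg (principalMinor A {l}))
    nlinarith

end PrincipalMinors

/-! ### Bounds for the logarithms of minors along the rays -/

namespace MinorCone

/-- The set with binary code `m`. -/
def codeSet (m : ℕ) : Finset (Fin 4) := {i | m.testBit i}

theorem codeSet_code_pair : ∀ i j : Fin 4, i ≠ j → codeSet (code [i, j]) = {i, j} := by decide

theorem codeSet_code_triple : ∀ i j k : Fin 4, i ≠ j → i ≠ k → j ≠ k →
    codeSet (code [i, j, k]) = {i, j, k} := by decide

theorem codeSet_code_quadruple : ∀ i j k l : Fin 4, [i, j, k, l].Nodup →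
    codeSet (code [i, j, k, l]) = Finset.univ := by decide

theorem insert_triple_eq_univ : ∀ i j k l : Fin 4, [i, j, k, l].Nodup →
    ({i, j, k, l} : Finset (Fin 4)) = Finset.univ := by decide

/-- The Möbius transform of a set function. -/
noncomputable def moebius (h : Finset (Fin 4) → ℝ) (S : Finset (Fin 4)) : ℝ :=
  ∑ T ∈ S.powerset, (-1) ^ (S.card - T.card) * h T

section

variable {h : Finset (Fin 4) → ℝ} {i j k l : Fin 4}

theorem moebius_pair (h0 : h ∅ = 0) (hij : i ≠ j) :
    moebius h {i, j} = h {i, j} - h {i} - h {j} := by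
  rw [moebius, Finset.sum_powerset_insert (by simpa using hij), ← insert_empty_eq j,
    Finset.sum_powerset_insert (by simp), Finset.sum_powerset_insert (by simp)]
  simp [hij, h0]
  ring

theorem moebius_triple (h0 : h ∅ = 0) (hij : i ≠ j) (hik : i ≠ k) (hjk : j ≠ k) :
    moebius h {i, j, k} =
      h {i, j, k} - h {i, j} - h {i, k} - h {j, k} + h {i} + h {j} + h {k} := by
  rw [moebius, ← insert_empty_eq k]
  repeat rw [Finset.sum_powerset_insert (by simp [hij, hik, hjk])]
  simp [hij, hik, hjk, h0]
  ring

theorem moebius_quadruple (h0 : h ∅ = 0) (hn : [i, j, k, l].Nodup) :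
    moebius h Finset.univ = h Finset.univ - h {i, j, k} - h {i, j, l} - h {i, k, l} - h {j, k, l} +
      h {i, j} + h {i, k} + h {i, l} + h {j, k} + h {j, l} + h {k, l} -
      h {i} - h {j} - h {k} - h {l} := by
  have hu := insert_triple_eq_univ i j k l hn
  simp only [List.nodup_cons, List.mem_cons, List.not_mem_nil, or_false, not_or, not_false_eq_true,
    List.nodup_nil, and_true] at hn
  obtain ⟨⟨hij, hik, hil⟩, ⟨hjk, hjl⟩, hkl⟩ := hn
  rw [← hu, moebius, ← insert_empty_eq l]
  repeat rw [Finset.sum_powerset_insert (by simp [hij, hik, hil, hjk, hjl, hkl])]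
  simp [hij, hik, hil, hjk, hjl, hkl, h0]
  ring

end

/-- The properties of logarithms of principal minors that yield bounds for ratios. -/
structure LogMinorLike (c : ℝ) (h : Finset (Fin 4) → ℝ) : Prop where
  nonneg : 0 ≤ c
  empty : h ∅ = 0
  koteljanskii : ∀ i j : Fin 4, ∀ K : Finset (Fin 4), i ≠ j → i ∉ K → j ∉ K →
    h (insert i (insert j K)) + h K ≤ h (insert i K) + h (insert j K)
  exchange : ∀ i j k : Fin 4, ∀ K : Finset (Fin 4), i ≠ j → i ≠ k → j ≠ k → i ∉ K → j ∉ K → k ∉ K →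
    h (insert i K) + h (insert j (insert k K)) ≤ c + h (insert i (insert j K)) + h (insert k K) ∨
    h (insert i K) + h (insert j (insert k K)) ≤ c + h (insert i (insert k K)) + h (insert j K)

/-- Expanded through the Möbius transform, the first three families are Koteljanskii inequalities,
bounded by `0`. Each of the other five uses one exchange, either outcome of which leaves a sum of
Koteljanskii inequalities. -/
theorem LogMinorLike.rayFamilies_le {c : ℝ} {h : Finset (Fin 4) → ℝ} (H : LogMinorLike c h)
    {i j k l : Fin 4} (hn : [i, j, k, l].Nodup) {r : List (List (Fin 4))}
    (hr : r ∈ rayFamilies i j k l) : (r.map fun s => moebius h (codeSet (code s))).sum ≤ c := by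
  have hn' := hn
  simp only [List.nodup_cons, List.mem_cons, List.not_mem_nil, or_false, not_or, not_false_eq_true,
    List.nodup_nil, and_true] at hn
  obtain ⟨⟨hij, hik, hil⟩, ⟨hjk, hjl⟩, hkl⟩ := hn
  have pair : ∀ a b : Fin 4, a ≠ b → moebius h (codeSet (code [a, b])) = h {a, b} - h {a} - h {b} :=
    fun a b hab => by rw [codeSet_code_pair a b hab, moebius_pair H.empty hab]
  have triple : ∀ a b d : Fin 4, a ≠ b → a ≠ d → b ≠ d → moebius h (codeSet (code [a, b, d])) =
      h {a, b, d} - h {a, b} - h {a, d} - h {b, d} + h {a} + h {b} + h {d} :=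
    fun a b d hab had hbd => by
      rw [codeSet_code_triple a b d hab had hbd, moebius_triple H.empty hab had hbd]
  have quad := moebius_quadruple H.empty hn'
  have k2 : ∀ a b : Fin 4, a ≠ b → h {a, b} ≤ h {a} + h {b} := fun a b hab => by
    simpa [H.empty] using H.koteljanskii a b ∅ hab (by simp) (by simp)
  -- These bring each set to one fixed spelling, so that linear arithmetic sees equal values of `h`
  -- as the same atom.
  have p1 : ∀ a b : Fin 4, ({b, a} : Finset (Fin 4)) = {a, b} := by decide
  have t1 : ∀ a b d : Fin 4, ({a, d, b} : Finset (Fin 4)) = {a, b, d} := by decide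
  have t2 : ∀ a b d : Fin 4, ({b, a, d} : Finset (Fin 4)) = {a, b, d} := by decide
  have t3 : ∀ a b d : Fin 4, ({b, d, a} : Finset (Fin 4)) = {a, b, d} := by decide
  have t4 : ∀ a b d : Fin 4, ({d, a, b} : Finset (Fin 4)) = {a, b, d} := by decide
  have k3 : ∀ a b d : Fin 4, a ≠ b → a ≠ d → b ≠ d →
      h {a, b, d} + h {a} ≤ h {a, b} + h {a, d} ∧ h {a, b, d} + h {b} ≤ h {a, b} + h {b, d} ∧
      h {a, b, d} + h {d} ≤ h {a, d} + h {b, d} := by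
    intro a b d hab had hbd
    have h1 := H.koteljanskii b d {a} hbd (by simpa using hab.symm) (by simpa using had.symm)
    have h2 := H.koteljanskii a d {b} had (by simpa using hab) (by simpa using hbd.symm)
    have h3 := H.koteljanskii a b {d} hab (by simpa using had) (by simpa using hbd)
    rw [t3, p1 a b, p1 a d] at h1
    rw [t1, p1 b d] at h2
    exact ⟨h1, h2, h3⟩
  have k4 : ∀ a b d e : Fin 4, [a, b, d, e].Nodup →
      h Finset.univ + h {d, e} ≤ h {a, d, e} + h {b, d, e} := by
    intro a b d e hab
    rw [← insert_triple_eq_univ a b d e hab]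
    simp only [List.nodup_cons, List.mem_cons, List.not_mem_nil, or_false, not_or] at hab
    exact H.koteljanskii a b {d, e} hab.1.1 (by simp [hab.1]) (by simp [hab.2.1])
  obtain ⟨ijk1, ijk2, ijk3⟩ := k3 i j k hij hik hjk
  obtain ⟨ijl1, ijl2, ijl3⟩ := k3 i j l hij hil hjl
  obtain ⟨ikl1, ikl2, ikl3⟩ := k3 i k l hik hil hkl
  obtain ⟨jkl1, jkl2, jkl3⟩ := k3 j k l hjk hjl hkl
  have kl := k4 i j k l (by simp; tauto)
  have jl := k4 i k j l (by simp; tauto)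
  have jk := k4 i l j k (by simp; tauto)
  have il := k4 j k i l (by simp; tauto)
  have ik := k4 j l i k (by simp; tauto)
  have ij := k4 k l i j (by simp; tauto)
  rw [t2 j k l] at jl
  rw [t4 j k l] at jk
  rw [t2 i j l, t2 i k l] at il
  rw [t2 i j k, t4 i k l] at ik
  rw [t4 i j k, t4 i j l] at ij
  have e3 : h {i} + h {k, l} ≤ c + h {i, k} + h {l} ∨ h {i} + h {k, l} ≤ c + h {i, l} + h {k} :=
    H.exchange i k l ∅ hik hil hkl (by simp) (by simp) (by simp)
  have e4 : h {i, l} + h {j, k, l} ≤ c + h {i, j, l} + h {k, l} ∨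
      h {i, l} + h {j, k, l} ≤ c + h {i, k, l} + h {j, l} :=
    H.exchange i j k {l} hij hik hjk (by simpa using hil) (by simpa using hjl) (by simpa using hkl)
  have e4' : h {i, l} + h {i, j, k} ≤ c + h {i, j, l} + h {i, k} ∨
      h {i, l} + h {i, j, k} ≤ c + h {i, k, l} + h {i, j} := by
    have := H.exchange l j k {i} (Ne.symm hjl) (Ne.symm hkl) hjk (by simpa using Ne.symm hil)
      (by simpa using Ne.symm hij) (by simpa using Ne.symm hik)
    rwa [p1 i l, t3 i j k, p1 i k, p1 i j,
      t4 i j l, t4 i k l] at this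
  have hc := H.nonneg
  simp only [rayFamilies, List.mem_cons, List.not_mem_nil, or_false] at hr
  rcases hr with rfl | rfl | rfl | rfl | rfl | rfl | rfl | rfl <;>
    simp only [List.map_cons, List.map_nil, List.sum_cons, List.sum_nil,
      pair _ _ hij, pair _ _ hik, pair _ _ hjk, pair _ _ hjl, pair _ _ hkl, triple _ _ _ hij hik hjk,
      triple _ _ _ hij hil hjl, triple _ _ _ hik hil hkl, triple _ _ _ hjk hjl hkl,
      codeSet_code_quadruple i j k l hn', quad]
  · linarith [k2 i j hij]
  · linarith
  · linarith
  · rcases e3 with e3 | e3 <;> linarith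
  · rcases e4' with e4' | e4' <;> linarith [k2 j l hjl, k2 k l hkl]
  · rcases e3 with e3 | e3 <;> linarith [k2 j l hjl, k2 j k hjk]
  · rcases e4 with e4 | e4 <;> linarith [k2 i j hij, k2 k l hkl, k2 i k hik, k2 j l hjl]
  · rcases e3 with e3 | e3 <;> linarith [k2 j k hjk, k2 j l hjl]

/-- The pairing of a vector of coordinates with the Möbius transform of `h`. -/
noncomputable def pairing (h : Finset (Fin 4) → ℝ) (v : ℕ → ℝ) : ℝ :=
  (largeCodes.map fun m => v m * moebius h (codeSet m)).sum

theorem pairing_add (h : Finset (Fin 4) → ℝ) (v w : ℕ → ℝ) :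
    pairing h (v + w) = pairing h v + pairing h w := by
  simp only [pairing, Pi.add_apply, add_mul, List.sum_map_add]

theorem pairing_smul (h : Finset (Fin 4) → ℝ) (c : ℝ) (v : ℕ → ℝ) :
    pairing h (c • v) = c * pairing h v := by
  simp only [pairing, Pi.smul_apply, smul_eq_mul, mul_assoc, List.sum_map_mul_left]

theorem pairing_vec_indicator (h : Finset (Fin 4) → ℝ) {l : List ℕ} (hl : ∀ m ∈ l, m ∈ largeCodes) :
    pairing h (vec (indicator l)) = (l.map fun m => moebius h (codeSet m)).sum := by
  have hvec : ∀ (l : List ℕ), ∀ m ∈ largeCodes, vec (indicator l) m = (l.count m : ℝ) := by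
    intro l m hm
    have : m < 16 := by
      revert m
      decide
    simp [vec, indicator, this]
  have hcount : ∀ l : List ℕ, pairing h (vec (indicator l)) =
      (largeCodes.map fun m => (l.count m : ℝ) * moebius h (codeSet m)).sum := fun l =>
    congrArg List.sum (List.map_congr_left fun m hm => by rw [hvec l m hm])
  rw [hcount]
  induction l with
  | nil => simp [largeCodes]
  | cons a l ih =>
    have ha := hl a List.mem_cons_self
    rw [List.map_cons, List.sum_cons, ← ih fun m hm => hl m (List.mem_cons_of_mem _ hm)]
    simp only [List.count_cons, Nat.cast_add, add_mul, List.sum_map_add]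
    rw [add_comm]
    congr 1
    simp only [largeCodes, List.mem_cons, List.not_mem_nil, or_false] at ha
    rcases ha with rfl | rfl | rfl | rfl | rfl | rfl | rfl | rfl | rfl | rfl | rfl <;>
      simp [largeCodes]

theorem code_mem_largeCodes : ∀ i j k l : Fin 4, [i, j, k, l].Nodup → ∀ r ∈ rayFamilies i j k l,
    ∀ s ∈ r, code s ∈ largeCodes := by
  decide +kernel

theorem LogMinorLike.pairing_permutedRays_le {c : ℝ} {h : Finset (Fin 4) → ℝ}
    (H : LogMinorLike c h) {r : List ℕ} (hr : r ∈ permutedRays) : pairing h (vec r) ≤ c := by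
  simp only [permutedRays, List.mem_flatMap] at hr
  obtain ⟨i, -, j, -, k, -, l, -, hr⟩ := hr
  split at hr
  · rename_i hn
    obtain ⟨s, hs, rfl⟩ := List.mem_map.1 hr
    rw [pairing_vec_indicator, List.map_map]
    · exact H.rayFamilies_le hn hs
    · intro m hm
      obtain ⟨t, ht, rfl⟩ := List.mem_map.1 hm
      exact code_mem_largeCodes i j k l hn s hs t ht
  · simp at hr

/-- The pairing of a vector in the cone with logarithms of principal minors is bounded. -/
theorem exists_pairing_le (c : ℝ) {v : ℕ → ℝ} (hv : v ∈ cone permutedRays) :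
    ∃ C, ∀ h, LogMinorLike c h → pairing h v ≤ C := by
  induction hv using Submodule.span_induction with
  | mem v hv =>
    obtain ⟨r, hr, rfl⟩ := hv
    exact ⟨c, fun h H => H.pairing_permutedRays_le hr⟩
  | zero => exact ⟨0, fun h _ => by simp [pairing]⟩
  | add v w _ _ hv hw =>
    obtain ⟨C, hC⟩ := hv
    obtain ⟨D, hD⟩ := hw
    exact ⟨C + D, fun h H => by rw [pairing_add]; exact add_le_add (hC h H) (hD h H)⟩
  | smul a v _ hv =>
    obtain ⟨C, hC⟩ := hv
    refine ⟨a * C, fun h H => ?_⟩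
    rw [NNReal.smul_def, pairing_smul]
    exact mul_le_mul_of_nonneg_left (hC h H) a.2

end MinorCone

theorem Matrix.PosDef.logMinorLike {𝕜 : Type*} [RCLike 𝕜] {A : Matrix (Fin 4) (Fin 4) 𝕜}
    (hA : A.PosDef) : MinorCone.LogMinorLike (Real.log 4) fun S => Real.log (principalMinor A S) := by
  have pos := hA.principalMinor_pos
  have log_mul : ∀ S T, Real.log (principalMinor A S) + Real.log (principalMinor A T) =
      Real.log (principalMinor A S * principalMinor A T) := fun S T =>
    (Real.log_mul (pos S).ne' (pos T).ne').symm
  refine ⟨Real.log_nonneg (by norm_num), by simp [principalMinor_empty], ?_, ?_⟩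
  · intro i j K hij hi hj
    simp only [log_mul]
    exact Real.log_le_log (mul_pos (pos _) (pos _)) (hA.principalMinor_koteljanskii hij hi hj)
  · intro i j k K hij hik hjk hi hj hk
    have h := hA.principalMinor_exchange hij hik hjk hi hj hk
    simp only [add_assoc, log_mul]
    rw [← Real.log_mul (by norm_num) (mul_pos (pos _) (pos _)).ne',
      ← Real.log_mul (by norm_num) (mul_pos (pos _) (pos _)).ne']
    have h0 := mul_pos (pos (insert i K)) (pos (insert j (insert k K)))
    -- A sum is at most twice its larger term, so the factor `2` of the exchange inequality becomes
    -- `4`.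
    rcases le_total (principalMinor A (insert i (insert j K)) * principalMinor A (insert k K))
      (principalMinor A (insert i (insert k K)) * principalMinor A (insert j K)) with h' | h'
    · exact Or.inr (Real.log_le_log h0 (by linarith))
    · exact Or.inl (Real.log_le_log h0 (by linarith))

/-! ### Nullities of the seven matrices -/

section Nullity

open Matrix

variable {𝕜 : Type*} [RCLike 𝕜] {m n : ℕ} (M : Matrix (Fin m) (Fin n) 𝕜)

/-- The columns of `M` in `T` are linearly independent. -/
def IndepColumns (T : Finset (Fin n)) : Prop :=
  ∀ y : Fin n → 𝕜, (∀ j, j ∉ T → y j = 0) → M *ᵥ y = 0 → y = 0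

/-- The dimension of the null space of the columns of `M` in `T`. -/
noncomputable def columnNullity (T : Finset (Fin n)) : ℕ :=
  Module.finrank 𝕜 (LinearMap.ker (M.submatrix id (fun j : T => (j : Fin n))).mulVecLin)

theorem columnNullity_add_rank (T : Finset (Fin n)) :
    columnNullity M T + (M.submatrix id (fun j : T => (j : Fin n))).rank = T.card := by
  rw [columnNullity, Matrix.rank, add_comm, LinearMap.finrank_range_add_finrank_ker]
  simp

theorem submatrix_mulVec_extend (T : Finset (Fin n)) (y : Fin n → 𝕜) (hy : ∀ j, j ∉ T → y j = 0) :
    M.submatrix id (fun j : T => (j : Fin n)) *ᵥ (fun j : T => y j) = M *ᵥ y := by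
  funext i
  simp only [mulVec, dotProduct, submatrix_apply, id]
  rw [Finset.sum_coe_sort T fun j => M i j * y j]
  exact Finset.sum_subset (Finset.subset_univ T) fun j _ hj => by rw [hy j hj, mul_zero]

theorem columnNullity_eq_zero {M : Matrix (Fin m) (Fin n) 𝕜} {T : Finset (Fin n)}
    (h : IndepColumns M T) : columnNullity M T = 0 := by
  rw [columnNullity, Submodule.finrank_eq_zero, LinearMap.ker_eq_bot']
  intro x hx
  let y : Fin n → 𝕜 := fun j => if hj : j ∈ T then x ⟨j, hj⟩ else 0
  have hyx : (fun j : T => y j) = x := by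
    funext j
    simp [y]
  have hy : ∀ j, j ∉ T → y j = 0 := fun j hj => by simp [y, hj]
  have hy0 : y = 0 := h y hy (by rw [← submatrix_mulVec_extend M T y hy, hyx]; exact hx)
  rw [← hyx, hy0]
  rfl

theorem columnNullity_pos {M : Matrix (Fin m) (Fin n) 𝕜} {T : Finset (Fin n)} (y : Fin n → 𝕜)
    (hy : ∀ j, j ∉ T → y j = 0) (hM : M *ᵥ y = 0) (hy0 : y ≠ 0) : 0 < columnNullity M T := by
  rw [columnNullity, Module.finrank_pos_iff, Submodule.nontrivial_iff_ne_bot]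
  intro h
  refine hy0 (funext fun j => ?_)
  by_cases hj : j ∈ T
  · have : (fun j : T => y j) = 0 := by
      rw [LinearMap.ker_eq_bot'] at h
      exact h _ (by rw [mulVecLin_apply, submatrix_mulVec_extend M T y hy, hM])
    exact congrFun this ⟨j, hj⟩
  · exact hy j hj

theorem rank_columns_mono {S T : Finset (Fin n)} (h : S ⊆ T) :
    (M.submatrix id (fun j : S => (j : Fin n))).rank ≤
      (M.submatrix id (fun j : T => (j : Fin n))).rank := by
  rw [rank_eq_finrank_span_cols, rank_eq_finrank_span_cols]
  refine Submodule.finrank_mono (Submodule.span_mono ?_)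
  rintro _ ⟨j, rfl⟩
  exact ⟨⟨j, h j.2⟩, rfl⟩

theorem IndepColumns.mono {M : Matrix (Fin m) (Fin n) 𝕜} {S T : Finset (Fin n)}
    (hT : IndepColumns M T) (h : S ⊆ T) : IndepColumns M S :=
  fun y hy => hT y fun j hj => hy j fun hjS => hj (h hjS)

/-- Rank-nullity, as the columns in `T` have rank at least `S.card`. Together with
`card_le_columnNullity_add` this determines the nullity of any set containing a basis of size `m`.
-/
theorem columnNullity_add_card_le {M : Matrix (Fin m) (Fin n) 𝕜} {S T : Finset (Fin n)}
    (hS : IndepColumns M S) (h : S ⊆ T) : columnNullity M T + S.card ≤ T.card := by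
  have h1 := columnNullity_add_rank M S
  rw [columnNullity_eq_zero hS, zero_add] at h1
  have h3 := rank_columns_mono M h
  rw [h1] at h3
  exact (Nat.add_le_add_left h3 _).trans_eq (columnNullity_add_rank M T)

theorem card_le_columnNullity_add (T : Finset (Fin n)) : T.card ≤ columnNullity M T + m := by
  have h := rank_le_card_height (M.submatrix id (fun j : T => (j : Fin n)))
  rw [Fintype.card_fin] at h
  exact (columnNullity_add_rank M T).symm.le.trans (Nat.add_le_add_left h _)

/-- The nullities of a matrix with `m` rows whose sets of `m` columns are all bases, except possibly
`X`, which has nullity `1`. -/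
theorem columnNullity_eq_of_bases {M : Matrix (Fin m) (Fin n) 𝕜} (X : Finset (Fin n))
    (B : Finset (Finset (Fin n))) (hcard : ∀ I ∈ B, I.card = m) (hB : ∀ I ∈ B, IndepColumns M I)
    (hT : ∀ T, T ≠ X → ∃ I ∈ B, T ⊆ I ∨ I ⊆ T) (hX : columnNullity M X = 1) (T : Finset (Fin n)) :
    columnNullity M T = if T = X then 1 else T.card - m := by
  split_ifs with h
  · rw [h, hX]
  · obtain ⟨I, hI, hTI | hTI⟩ := hT T h
    · have := Finset.card_le_card hTI
      rw [hcard I hI] at this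
      rw [columnNullity_eq_zero ((hB I hI).mono hTI), Nat.sub_eq_zero_of_le this]
    · have h1 := columnNullity_add_card_le (hB I hI) hTI
      have h2 := card_le_columnNullity_add M T
      rw [hcard I hI] at h1
      omega

theorem columnNullity_submatrix (σ : Equiv.Perm (Fin n)) (T : Finset (Fin n)) :
    columnNullity (M.submatrix id σ) T = columnNullity M (T.map σ.toEmbedding) := by
  have h1 := columnNullity_add_rank (M.submatrix id σ) T
  have h2 := columnNullity_add_rank M (T.map σ.toEmbedding)
  rw [Finset.card_map] at h2
  have h3 : ((M.submatrix id σ).submatrix id (fun j : T => (j : Fin n))).rank =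
      (M.submatrix id (fun j : (T.map σ.toEmbedding : Finset (Fin n)) => (j : Fin n))).rank := by
    have hrange : Set.range ((M.submatrix id σ).submatrix id (fun j : T => (j : Fin n))).col =
        Set.range (M.submatrix id (fun j : (T.map σ.toEmbedding : Finset (Fin n)) => (j : Fin n))).col := by
      ext v
      constructor
      · rintro ⟨j, rfl⟩
        exact ⟨⟨σ j, Finset.mem_map_of_mem _ j.2⟩, rfl⟩
      · rintro ⟨⟨j, hj⟩, rfl⟩
        obtain ⟨k, hk, rfl⟩ := Finset.mem_map.1 hj
        exact ⟨⟨k, hk⟩, rfl⟩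
    rw [rank_eq_finrank_span_cols, rank_eq_finrank_span_cols, hrange]
  omega

theorem Fin.four_cases : ∀ j : Fin 4, j = 0 ∨ j = 1 ∨ j = 2 ∨ j = 3 := by decide

theorem columnNullity_rowMatrix (S T : Finset (Fin n)) :
    columnNullity (rowMatrix 𝕜 S) T = T.card - if T ⊆ S then 0 else 1 := by
  split_ifs with h
  · have h1 := columnNullity_add_rank (rowMatrix 𝕜 S) T
    have h2 : (rowMatrix 𝕜 S).submatrix id (fun j : T => (j : Fin n)) = 0 := by
      ext i j
      simp [rowMatrix, h j.2]
    rw [h2, rank_zero] at h1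
    omega
  · obtain ⟨j, hjT, hjS⟩ := Finset.not_subset.1 h
    have h1 : IndepColumns (rowMatrix 𝕜 S) {j} := by
      intro y hy hM
      have h0 : y j = 0 := by
        have := congrFun hM 0
        rw [mulVec, dotProduct, Finset.sum_eq_single j (fun k _ hk => by
          rw [hy k (by simpa using hk), mul_zero]) (by simp)] at this
        simpa [rowMatrix, hjS] using this
      funext k
      by_cases hk : k = j
      · rw [hk, h0]
        rfl
      · exact hy k (by simpa using hk)
    have h2 := columnNullity_add_card_le h1 (Finset.singleton_subset_iff.2 hjT)
    have h3 := card_le_columnNullity_add (rowMatrix 𝕜 S) T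
    rw [Finset.card_singleton] at h2
    omega

theorem columnNullity_circuitMatrix₃ (T : Finset (Fin 4)) :
    columnNullity (circuitMatrix₃ 𝕜) T = if T = {0, 1, 2} then 1 else T.card - 3 := by
  have heq : ∀ y : Fin 4 → 𝕜, circuitMatrix₃ 𝕜 *ᵥ y = 0 → y 0 + y 2 = 0 ∧ y 1 + y 2 = 0 ∧ y 3 = 0 := by
    intro y hy
    refine ⟨?_, ?_, ?_⟩
    · simpa [circuitMatrix₃, mulVec, dotProduct, Fin.sum_univ_succ] using congrFun hy 0
    · simpa [circuitMatrix₃, mulVec, dotProduct, Fin.sum_univ_succ] using congrFun hy 1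
    · simpa [circuitMatrix₃, mulVec, dotProduct, Fin.sum_univ_succ] using congrFun hy 2
  have hind : ∀ j : Fin 4, j ≠ 3 → IndepColumns (circuitMatrix₃ 𝕜) {j}ᶜ := by
    intro j hj y hy hM
    obtain ⟨h0, h1, h3⟩ := heq y hM
    have hyj := hy j (by simp)
    have h2 : y 2 = 0 := by
      rcases Fin.four_cases j with rfl | rfl | rfl | rfl
      · linear_combination h0 - hyj
      · linear_combination h1 - hyj
      · exact hyj
      · simp at hj
    funext k
    fin_cases k
    · exact (by linear_combination h0 - h2 : y 0 = 0)
    · exact (by linear_combination h1 - h2 : y 1 = 0)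
    · exact h2
    · exact h3
  refine columnNullity_eq_of_bases _ {{0}ᶜ, {1}ᶜ, {2}ᶜ} (by decide) ?_ (by decide) ?_ T
  · intro I hI
    simp only [Finset.mem_insert, Finset.mem_singleton] at hI
    rcases hI with rfl | rfl | rfl <;> exact hind _ (by decide)
  · have h1 := columnNullity_add_card_le ((hind 2 (by decide)).mono (S := {0, 1}) (by decide))
      (T := {0, 1, 2}) (by decide)
    -- The witness is the linear relation on the circuit: the third column is the sum of the first
    -- two.
    have h2 := columnNullity_pos (M := circuitMatrix₃ 𝕜) (T := {0, 1, 2}) ![1, 1, -1, 0]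
      (by intro j hj; rcases Fin.four_cases j with rfl | rfl | rfl | rfl <;> simp_all) (by
        funext i
        fin_cases i <;> simp [circuitMatrix₃, mulVec, dotProduct, Fin.sum_univ_succ])
      (fun h => by simpa using congrFun h 0)
    have h3 : ({0, 1} : Finset (Fin 4)).card = 2 := rfl
    have h4 : ({0, 1, 2} : Finset (Fin 4)).card = 3 := rfl
    omega

theorem columnNullity_circuitMatrix₄ (T : Finset (Fin 4)) :
    columnNullity (circuitMatrix₄ 𝕜) T = T.card - 3 := by
  have hind : ∀ j : Fin 4, IndepColumns (circuitMatrix₄ 𝕜) {j}ᶜ := by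
    intro j y hy hM
    have h0 : y 0 + y 3 = 0 := by
      simpa [circuitMatrix₄, mulVec, dotProduct, Fin.sum_univ_succ] using congrFun hM 0
    have h1 : y 1 + y 3 = 0 := by
      simpa [circuitMatrix₄, mulVec, dotProduct, Fin.sum_univ_succ] using congrFun hM 1
    have h2 : y 2 + y 3 = 0 := by
      simpa [circuitMatrix₄, mulVec, dotProduct, Fin.sum_univ_succ] using congrFun hM 2
    have hyj := hy j (by simp)
    have h3 : y 3 = 0 := by
      rcases Fin.four_cases j with rfl | rfl | rfl | rfl
      · linear_combination h0 - hyj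
      · linear_combination h1 - hyj
      · linear_combination h2 - hyj
      · exact hyj
    funext k
    fin_cases k
    · exact (by linear_combination h0 - h3 : y 0 = 0)
    · exact (by linear_combination h1 - h3 : y 1 = 0)
    · exact (by linear_combination h2 - h3 : y 2 = 0)
    · exact h3
  have hX : columnNullity (circuitMatrix₄ 𝕜) Finset.univ = 1 := by
    have h1 := columnNullity_add_card_le (hind 0) (Finset.subset_univ _)
    have h2 := card_le_columnNullity_add (circuitMatrix₄ 𝕜) Finset.univ
    have h3 : (({0}ᶜ : Finset (Fin 4))).card = 3 := rfl
    simp only [Finset.card_univ, Fintype.card_fin] at h1 h2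
    omega
  -- Here the exceptional set is not exceptional: the value `1` at `univ` agrees with `4 - 3`.
  rw [columnNullity_eq_of_bases Finset.univ {{0}ᶜ, {1}ᶜ, {2}ᶜ, {3}ᶜ} (by decide) ?_ (by decide) hX T]
  · split_ifs with h
    · rw [h]
      rfl
    · rfl
  · intro I hI
    simp only [Finset.mem_insert, Finset.mem_singleton] at hI
    rcases hI with rfl | rfl | rfl | rfl <;> exact hind _

theorem columnNullity_matrix₆ (T : Finset (Fin 4)) :
    columnNullity (matrix₆ 𝕜) T = if T = {2, 3} then 1 else T.card - 2 := by
  have hind : ∀ I ∈ ({{0, 1}, {0, 2}, {0, 3}, {1, 2}, {1, 3}} : Finset (Finset (Fin 4))),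
      IndepColumns (matrix₆ 𝕜) I := by
    intro I hI y hy hM
    have h0 : y 0 + (y 2 + y 3) = 0 := by
      simpa [matrix₆, mulVec, dotProduct, Fin.sum_univ_succ] using congrFun hM 0
    have h1 : y 1 + (y 2 + y 3) = 0 := by
      simpa [matrix₆, mulVec, dotProduct, Fin.sum_univ_succ] using congrFun hM 1
    simp only [Finset.mem_insert, Finset.mem_singleton] at hI
    have hy0 := hy 0
    have hy1 := hy 1
    have hy2 := hy 2
    have hy3 := hy 3
    funext k
    rcases hI with rfl | rfl | rfl | rfl | rfl <;> simp at hy0 hy1 hy2 hy3 <;>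
      simp_all <;> fin_cases k <;> simp_all
  refine columnNullity_eq_of_bases _ _ (by decide) hind (by decide) ?_ T
  have h1 := columnNullity_add_card_le ((hind {0, 2} (by decide)).mono (S := {2}) (by decide))
    (T := {2, 3}) (by decide)
  have h2 := columnNullity_pos (M := matrix₆ 𝕜) (T := {2, 3}) ![0, 0, 1, -1]
    (by intro j hj; rcases Fin.four_cases j with rfl | rfl | rfl | rfl <;> simp_all) (by
      funext i
      fin_cases i <;> simp [matrix₆, mulVec, dotProduct, Fin.sum_univ_succ])
    (fun h => by simpa using congrFun h 2)
  have h3 : ({2} : Finset (Fin 4)).card = 1 := rfl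
  have h4 : ({2, 3} : Finset (Fin 4)).card = 2 := rfl
  omega

theorem columnNullity_matrix₇ (T : Finset (Fin 4)) :
    columnNullity (matrix₇ 𝕜) T = T.card - 2 := by
  have hrow : ∀ j, matrix₇ 𝕜 0 j = 1 ∧ matrix₇ 𝕜 1 j = ((j : ℕ) : 𝕜) := by
    intro j
    rcases Fin.four_cases j with rfl | rfl | rfl | rfl <;> simp [matrix₇]
  have hind : ∀ i j : Fin 4, i ≠ j → IndepColumns (matrix₇ 𝕜) {i, j} := by
    intro i j hij y hy hM
    have h := congrFun hM
    simp only [mulVec, dotProduct, Pi.zero_apply] at h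
    have hsum : ∀ r, ∑ k, matrix₇ 𝕜 r k * y k = matrix₇ 𝕜 r i * y i + matrix₇ 𝕜 r j * y j := by
      intro r
      rw [← Finset.sum_pair (f := fun k => matrix₇ 𝕜 r k * y k) hij]
      exact (Finset.sum_subset (Finset.subset_univ _) fun k _ hk => by rw [hy k hk, mul_zero]).symm
    have h0 := h 0
    have h1 := h 1
    rw [hsum, (hrow i).1, (hrow j).1] at h0
    rw [hsum, (hrow i).2, (hrow j).2] at h1
    -- The Vandermonde determinant of columns `i` and `j`, nonzero in characteristic zero.
    have hne : ((j : ℕ) : 𝕜) - ((i : ℕ) : 𝕜) ≠ 0 :=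
      sub_ne_zero.2 fun h' => hij (Fin.ext (Nat.cast_injective h').symm)
    have hyj : y j = 0 := by
      refine (mul_eq_zero.1 ?_).resolve_left hne
      linear_combination h1 - ((i : ℕ) : 𝕜) * h0
    funext k
    by_cases hki : k = i
    · rw [hki]
      exact (by linear_combination h0 - hyj : y i = 0)
    · by_cases hkj : k = j
      · rw [hkj, hyj]
        rfl
      · exact hy k (by simp [hki, hkj])
  by_cases h : T.card ≤ 2
  · obtain ⟨i, j, hij, hT⟩ : ∃ i j, i ≠ j ∧ T ⊆ {i, j} := by
      revert T
      decide
    rw [columnNullity_eq_zero ((hind i j hij).mono hT), Nat.sub_eq_zero_of_le h]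
  · obtain ⟨i, j, hij, hT⟩ : ∃ i j, i ≠ j ∧ {i, j} ⊆ T := by
      revert T
      decide
    have h1 := columnNullity_add_card_le (hind i j hij) hT
    have h2 := card_le_columnNullity_add (matrix₇ 𝕜) T
    rw [Finset.card_pair hij] at h1
    omega

end Nullity

/-! ### Order of vanishing of the minors of `Mᴴ * M + t` -/

section Asymptotics

open Matrix Filter Topology

theorem tendsto_log_add_div_log (a : ℝ) :
    Tendsto (fun t => Real.log (a + t) / Real.log t) (𝓝[>] 0) (𝓝 (if a = 0 then 1 else 0)) := by
  split_ifs with h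
  · refine (tendsto_congr' ?_).2 tendsto_const_nhds
    filter_upwards [Ioo_mem_nhdsGT one_pos] with t ht
    rw [h, zero_add, div_self (Real.log_neg ht.1 ht.2).ne]
  · have h1 : Tendsto (fun t => Real.log (a + t)) (𝓝[>] 0) (𝓝 (Real.log (a + 0))) := by
      have hc : ContinuousAt (fun t => Real.log (a + t)) 0 :=
        ContinuousAt.log (by fun_prop) (by simpa using h)
      exact hc.tendsto.mono_left nhdsWithin_le_nhds
    exact h1.div_atBot Real.tendsto_log_nhdsGT_zero

variable {𝕜 : Type*} [RCLike 𝕜]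

/-- Evaluate the characteristic polynomial at `-t` and cancel the common sign. -/
theorem Matrix.IsHermitian.det_add_smul_one {ι : Type*} [Fintype ι] [DecidableEq ι]
    {G : Matrix ι ι 𝕜} (hG : G.IsHermitian) (t : ℝ) :
    (G + (t : 𝕜) • (1 : Matrix ι ι 𝕜)).det = ((∏ i, (hG.eigenvalues i + t) : ℝ) : 𝕜) := by
  have h1 := eval_charpoly G (-t : 𝕜)
  rw [hG.charpoly_eq, Polynomial.eval_prod] at h1
  have h2 : scalar ι (-t : 𝕜) - G = -(G + (t : 𝕜) • (1 : Matrix ι ι 𝕜)) := by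
    rw [scalar_apply, ← smul_one_eq_diagonal, neg_smul]
    abel
  have h3 : ∀ i, Polynomial.eval (-t : 𝕜) (Polynomial.X - Polynomial.C (hG.eigenvalues i : 𝕜)) =
      -1 * ((hG.eigenvalues i + t : ℝ) : 𝕜) := fun i => by
    simp
    ring
  rw [h2, det_neg, Finset.prod_congr rfl fun i _ => h3 i, Finset.prod_mul_distrib, Finset.prod_const,
    Finset.card_univ] at h1
  rw [← mul_left_cancel₀ (pow_ne_zero _ (neg_ne_zero.2 one_ne_zero)) h1, RCLike.ofReal_prod]

variable {m n : ℕ} (M : Matrix (Fin m) (Fin n) 𝕜)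

theorem posDef_conjTranspose_mul_self_add {t : ℝ} (ht : 0 < t) :
    (Mᴴ * M + (t : 𝕜) • (1 : Matrix (Fin n) (Fin n) 𝕜)).PosDef := by
  refine PosDef.posSemidef_add (posSemidef_conjTranspose_mul_self M) ?_
  exact PosDef.one.smul (by exact_mod_cast ht)

/-- The principal minors of `Mᴴ * M + t` vanish at `t = 0` to the order given by the nullity. -/
theorem tendsto_log_principalMinor_div_log (T : Finset (Fin n)) :
    Tendsto (fun t : ℝ => Real.log (principalMinor (Mᴴ * M + (t : 𝕜) • 1) T) / Real.log t)
      (𝓝[>] 0) (𝓝 (nullityType M T)) := by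
  set N := M.submatrix id (fun j : T => (j : Fin n)) with hN
  have hG : (Nᴴ * N).PosSemidef := posSemidef_conjTranspose_mul_self N
  have hminor : ∀ t : ℝ, principalMinor (Mᴴ * M + (t : 𝕜) • 1) T =
      ∏ i, (hG.isHermitian.eigenvalues i + t) := by
    intro t
    have : (Mᴴ * M + (t : 𝕜) • (1 : Matrix (Fin n) (Fin n) 𝕜)).submatrix (fun i : T => (i : Fin n))
        (fun j : T => (j : Fin n)) = Nᴴ * N + (t : 𝕜) • (1 : Matrix T T 𝕜) := by
      ext i j
      simp only [submatrix_apply, Matrix.add_apply, mul_apply, conjTranspose_apply, Matrix.smul_apply,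
        one_apply, Subtype.ext_iff]
      rfl
    rw [principalMinor, this, hG.isHermitian.det_add_smul_one, RCLike.ofReal_re]
  -- `Nᴴ * N` has the same rank as `N`, so the nullity counts its zero eigenvalues; each of them
  -- contributes one factor `t` to the minor.
  have hnull : nullityType M T =
      ∑ i, if hG.isHermitian.eigenvalues i = 0 then (1 : ℝ) else 0 := by
    have h1 := columnNullity_add_rank M T
    rw [← hN, ← rank_conjTranspose_mul_self N, hG.isHermitian.rank_eq_card_non_zero_eigs,
      Fintype.card_subtype] at h1
    have h2 := Finset.card_filter_add_card_filter_not (s := (Finset.univ : Finset T))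
      (fun i => hG.isHermitian.eigenvalues i = 0)
    rw [Finset.card_univ, Fintype.card_coe] at h2
    have h3 : columnNullity M T =
        (Finset.univ.filter fun i => hG.isHermitian.eigenvalues i = 0).card := by
      simp only [ne_eq] at h1
      omega
    rw [Finset.sum_boole, ← h3]
    rfl
  rw [hnull]
  refine (tendsto_finsetSum Finset.univ fun i _ =>
    tendsto_log_add_div_log _).congr' ?_
  filter_upwards [self_mem_nhdsWithin] with t ht
  rw [hminor, Real.log_prod fun i _ => (add_pos_of_nonneg_of_pos (hG.eigenvalues_nonneg i) ht).ne',
    Finset.sum_div]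

end Asymptotics

/-! ### Logarithms of ratios and necessity of the conditions -/

section Ratios

open Matrix Filter Topology

variable {𝕜 : Type*} [RCLike 𝕜] {n : ℕ}

theorem IndexCollection.eval_pos (α : IndexCollection n) {A : Matrix (Fin n) (Fin n) 𝕜}
    (hA : A.PosDef) : 0 < α.eval A := by
  refine List.prod_pos fun x hx => ?_
  obtain ⟨p, -, rfl⟩ := List.mem_map.1 hx
  exact Real.rpow_pos_of_pos (hA.principalMinor_pos _) _

theorem IndexCollection.log_eval (α : IndexCollection n) {A : Matrix (Fin n) (Fin n) 𝕜}
    (hA : A.PosDef) :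
    Real.log (α.eval A) = ∑ T, α.exponent T * Real.log (principalMinor A T) := by
  induction α with
  | nil => simp [eval, exponent]
  | cons p α ih =>
    have h1 : eval (p :: α) A = principalMinor A p.1 ^ (p.2 : ℝ) * eval α A := rfl
    have h2 : ∀ T, exponent (p :: α) T = (if p.1 = T then (p.2 : ℝ) else 0) + exponent α T :=
      fun T => rfl
    rw [h1, Real.log_mul (Real.rpow_pos_of_pos (hA.principalMinor_pos _) _).ne' (eval_pos α hA).ne',
      Real.log_rpow (hA.principalMinor_pos _), ih]
    simp only [h2, add_mul, Finset.sum_add_distrib, ite_mul, zero_mul, Finset.sum_ite_eq,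
      Finset.mem_univ, if_true]

namespace MinorRatio

variable (R : MinorRatio n)

theorem eval_pos {A : Matrix (Fin n) (Fin n) 𝕜} (hA : A.PosDef) : 0 < R.eval A :=
  div_pos (R.num.eval_pos hA) (R.den.eval_pos hA)

theorem log_eval {A : Matrix (Fin n) (Fin n) 𝕜} (hA : A.PosDef) :
    Real.log (R.eval A) = ∑ T, R.formalLog T * Real.log (principalMinor A T) := by
  rw [eval, Real.log_div (R.num.eval_pos hA).ne' (R.den.eval_pos hA).ne', R.num.log_eval hA,
    R.den.log_eval hA, ← Finset.sum_sub_distrib]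
  refine Finset.sum_congr rfl fun T _ => ?_
  rw [← sub_mul]
  -- The normalising entry at `∅` is multiplied by `log 1 = 0`.
  rcases eq_or_ne T ∅ with rfl | h
  · simp [principalMinor_empty]
  · rw [formalLog, if_neg h]

theorem sum_formalLog : ∑ T, R.formalLog T = 0 := by
  rw [← Finset.sum_filter_add_sum_filter_not Finset.univ (fun S : Finset (Fin n) => S.Nonempty)]
  have h1 : ∑ T with T.Nonempty, R.formalLog T =
      ∑ T with T.Nonempty, (R.num.exponent T - R.den.exponent T) :=
    Finset.sum_congr rfl fun T hT => by
      rw [formalLog, if_neg (Finset.mem_filter.1 hT).2.ne_empty]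
  have h2 : (Finset.univ.filter fun T : Finset (Fin n) => ¬T.Nonempty) = {∅} := by
    ext T
    simp [Finset.not_nonempty_iff_eq_empty]
  rw [h1, h2, Finset.sum_singleton, formalLog, if_pos rfl, add_neg_cancel]

theorem principalMinor_diagonal (d : Fin n → ℝ) (T : Finset (Fin n)) :
    principalMinor (diagonal fun i => (d i : 𝕜)) T = ∏ i ∈ T, d i := by
  have : (diagonal fun i => (d i : 𝕜)).submatrix (fun i : T => (i : Fin n)) (fun j : T => (j : Fin n)) =
      diagonal fun i : T => (d i : 𝕜) :=
    submatrix_diagonal _ _ Subtype.val_injective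
  rw [principalMinor, this, det_diagonal, ← RCLike.ofReal_prod, RCLike.ofReal_re,
    Finset.prod_coe_sort T d]

theorem log_eval_diagonal {d : Fin n → ℝ} (hd : ∀ i, 0 < d i) :
    Real.log (R.eval (diagonal fun i => (d i : 𝕜))) =
      ∑ i, (∑ T with i ∈ T, R.formalLog T) * Real.log (d i) := by
  have hA : (diagonal fun i => (d i : 𝕜)).PosDef := PosDef.diagonal fun i => by exact_mod_cast hd i
  rw [R.log_eval hA]
  have h1 : ∀ T : Finset (Fin n), R.formalLog T *
      Real.log (principalMinor (diagonal fun i => (d i : 𝕜)) T) =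
      ∑ i, if i ∈ T then R.formalLog T * Real.log (d i) else 0 := fun T => by
    rw [principalMinor_diagonal, Real.log_prod fun i _ => (hd i).ne', Finset.mul_sum,
      ← Finset.sum_filter]
    simp
  simp only [h1]
  rw [Finset.sum_comm]
  refine Finset.sum_congr rfl fun i _ => ?_
  rw [← Finset.sum_filter, Finset.sum_mul]

theorem log_eval_single (i : Fin n) (s : ℝ) :
    Real.log (R.eval (diagonal fun j => ((Real.exp (if j = i then s else 0) : ℝ) : 𝕜))) =
      (∑ T with i ∈ T, R.formalLog T) * s := by
  rw [R.log_eval_diagonal fun j => Real.exp_pos _]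
  simp [Real.log_exp]

theorem posDef_single (i : Fin n) (s : ℝ) :
    (diagonal fun j => ((Real.exp (if j = i then s else 0) : ℝ) : 𝕜)).PosDef :=
  PosDef.diagonal fun j => by exact_mod_cast Real.exp_pos _

theorem mem_homogeneousRatios_iff :
    R ∈ homogeneousRatios 𝕜 n ↔ ∀ i, ∑ T with i ∈ T, R.formalLog T = 0 := by
  constructor
  · intro h i
    have := R.log_eval_single (𝕜 := 𝕜) i 1
    rw [h _ (isDiag_diagonal _) (posDef_single i 1), Real.log_one, mul_one] at this
    exact this.symm
  · intro h A hdiag hA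
    have hd : A = diagonal fun i => ((RCLike.re (A i i) : ℝ) : 𝕜) := by
      conv_lhs => rw [← hdiag.diagonal_diag]
      congr 1
      funext i
      exact (hA.ofReal_re_diag i).symm
    have hlog : Real.log (R.eval A) = 0 := by
      rw [hd, R.log_eval_diagonal fun i => (RCLike.pos_iff.1 hA.diag_pos).1]
      simp [h]
    exact Real.eq_one_of_pos_of_log_eq_zero (R.eval_pos hA) hlog

theorem exists_log_eval_le (h : R ∈ boundedRatios 𝕜 n) :
    ∃ C, ∀ A : Matrix (Fin n) (Fin n) 𝕜, A.PosDef → Real.log (R.eval A) ≤ C := by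
  obtain ⟨C, hC⟩ := h
  exact ⟨Real.log C, fun A hA => Real.log_le_log (R.eval_pos hA) (hC A hA)⟩

theorem mem_homogeneousRatios_of_mem_boundedRatios (h : R ∈ boundedRatios 𝕜 n) :
    R ∈ homogeneousRatios 𝕜 n := by
  rw [mem_homogeneousRatios_iff]
  intro i
  obtain ⟨C, hC⟩ := R.exists_log_eval_le h
  by_contra hne
  -- The logarithm of the ratio is linear in the parameter, which is chosen to make it equal `C +
  -- 1`.
  have := hC _ (posDef_single i ((C + 1) / ∑ T with i ∈ T, R.formalLog T))
  rw [log_eval_single, mul_div_cancel₀ _ hne] at this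
  linarith

theorem subsetInner_nullityType_nonneg (h : R ∈ boundedRatios 𝕜 n) {m : ℕ}
    (M : Matrix (Fin m) (Fin n) 𝕜) : 0 ≤ subsetInner R.formalLog (nullityType M) := by
  obtain ⟨C, hC⟩ := R.exists_log_eval_le h
  have h1 : Tendsto (fun t : ℝ => Real.log (R.eval (Mᴴ * M + (t : 𝕜) • 1)) / Real.log t) (𝓝[>] 0)
      (𝓝 (subsetInner R.formalLog (nullityType M))) := by
    refine (tendsto_finsetSum Finset.univ fun T _ =>
      (tendsto_log_principalMinor_div_log M T).const_mul (R.formalLog T)).congr' ?_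
    filter_upwards [self_mem_nhdsWithin] with t ht
    rw [R.log_eval (posDef_conjTranspose_mul_self_add M ht), Finset.sum_div]
    exact Finset.sum_congr rfl fun T _ => (mul_div_assoc _ _ _).symm
  have h2 : Tendsto (fun t : ℝ => C / Real.log t) (𝓝[>] 0) (𝓝 0) :=
    Tendsto.div_atBot tendsto_const_nhds Real.tendsto_log_nhdsGT_zero
  -- Division by `log t < 0` turns the upper bound `C` into a lower bound that tends to `0`.
  refine le_of_tendsto_of_tendsto h2 h1 ?_
  filter_upwards [Ioo_mem_nhdsGT one_pos] with t ht
  exact div_le_div_of_nonpos_of_le (Real.log_neg ht.1 ht.2).le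
    (hC _ (posDef_conjTranspose_mul_self_add M ht.1))

theorem mem_boundedRatios_of_log_le {C : ℝ}
    (h : ∀ A : Matrix (Fin n) (Fin n) 𝕜, A.PosDef → Real.log (R.eval A) ≤ C) :
    R ∈ boundedRatios 𝕜 n :=
  ⟨Real.exp C, fun A hA => (Real.log_le_iff_le_exp (R.eval_pos hA)).1 (h A hA)⟩

end MinorRatio

end Ratios

/-! ### Enumeration of the nullity types -/

section Tables

/-- The nullities of the matrix whose only row vanishes in the columns of `S`. -/
def rowTable (S T : Finset (Fin 4)) : ℕ := T.card - if T ⊆ S then 0 else 1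

/-- The nullities of a matrix with `m` rows whose sets of `m` columns are bases, except possibly `X`,
which has nullity `1`. -/
def basisTable (m : ℕ) (X T : Finset (Fin 4)) : ℕ := if T = X then 1 else T.card - m

def permutedTables (N : Finset (Fin 4) → ℕ) : Finset (Finset (Fin 4) → ℕ) :=
  Finset.univ.image fun σ : Equiv.Perm (Fin 4) => fun T => N (T.map σ.toEmbedding)

/-- The listed nullity types. -/
def listedTables : Finset (Finset (Fin 4) → ℕ) :=
  permutedTables (rowTable ∅) ∪ permutedTables (rowTable {0}) ∪ permutedTables (rowTable {0, 1}) ∪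
  permutedTables (basisTable 3 {0, 1, 2}) ∪ permutedTables (basisTable 3 Finset.univ) ∪
  permutedTables (basisTable 2 {2, 3}) ∪ permutedTables (fun T => T.card - 2)

/-- The orbits under column permutations have sizes `1`, `4`, `6`, `4`, `1`, `6` and `1`. -/
theorem card_listedTables : listedTables.card = 23 := by
  decide +kernel

theorem rowTable_mem_listedTables : ∀ S : Finset (Fin 4), S.card ≤ 2 → rowTable S ∈ listedTables := by
  decide +kernel

theorem basisTable_three_mem_listedTables :
    ∀ X : Finset (Fin 4), 3 ≤ X.card → basisTable 3 X ∈ listedTables := by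
  decide +kernel

theorem basisTable_two_mem_listedTables :
    ∀ X : Finset (Fin 4), X.card = 2 → basisTable 2 X ∈ listedTables := by
  decide +kernel

theorem uniformTable_mem_listedTables : (fun T : Finset (Fin 4) => T.card - 2) ∈ listedTables := by
  decide +kernel

end Tables

section Listed

variable (𝕜 : Type*) [RCLike 𝕜]

theorem permutedNullityTypes_eq {m : ℕ} {M : Matrix (Fin m) (Fin 4) 𝕜} {N : Finset (Fin 4) → ℕ}
    (h : ∀ T, columnNullity M T = N T) :
    permutedNullityTypes M =
      (fun (N : Finset (Fin 4) → ℕ) T => (N T : ℝ)) '' (permutedTables N : Set (Finset (Fin 4) → ℕ)) := by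
  rw [permutedTables, Finset.coe_image, Finset.coe_univ, Set.image_univ, ← Set.range_comp]
  refine congrArg Set.range (funext fun σ => funext fun T => ?_)
  change ((columnNullity (M.submatrix id σ) T : ℕ) : ℝ) = _
  rw [columnNullity_submatrix, h]
  rfl

theorem listedNullityTypes_eq :
    listedNullityTypes 𝕜 = (fun (N : Finset (Fin 4) → ℕ) T => (N T : ℝ)) '' (listedTables : Set (Finset (Fin 4) → ℕ)) := by
  have h4 : ∀ T, columnNullity (circuitMatrix₄ 𝕜) T = basisTable 3 Finset.univ T := by
    intro T
    rw [columnNullity_circuitMatrix₄, basisTable]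
    split_ifs with h
    · rw [h]
      rfl
    · rfl
  simp only [listedNullityTypes, listedTables, Finset.coe_union, Set.image_union,
    permutedNullityTypes_eq 𝕜 (columnNullity_rowMatrix (𝕜 := 𝕜) (n := 4) _),
    permutedNullityTypes_eq 𝕜 (columnNullity_circuitMatrix₃ (𝕜 := 𝕜)),
    permutedNullityTypes_eq 𝕜 h4, permutedNullityTypes_eq 𝕜 (columnNullity_matrix₆ (𝕜 := 𝕜)),
    permutedNullityTypes_eq 𝕜 (columnNullity_matrix₇ (𝕜 := 𝕜))]
  rfl

theorem ncard_listedNullityTypes : (listedNullityTypes 𝕜).ncard = 23 := by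
  rw [listedNullityTypes_eq, Set.ncard_image_of_injective, Set.ncard_coe_finset, card_listedTables]
  intro N N' h
  funext T
  exact Nat.cast_injective (congrFun h T)

theorem exists_nullityType_of_mem_listedNullityTypes {μ : Finset (Fin 4) → ℝ}
    (hμ : μ ∈ listedNullityTypes 𝕜) :
    ∃ (m : ℕ) (M : Matrix (Fin m) (Fin 4) 𝕜), nullityType M = μ := by
  simp only [listedNullityTypes, Set.mem_union, permutedNullityTypes, Set.mem_range] at hμ
  rcases hμ with (((((⟨σ, rfl⟩ | ⟨σ, rfl⟩) | ⟨σ, rfl⟩) | ⟨σ, rfl⟩) | ⟨σ, rfl⟩) | ⟨σ, rfl⟩) | ⟨σ, rfl⟩ <;>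
    exact ⟨_, _, rfl⟩

end Listed

/-! ### From exponents to coordinates of the cone -/

namespace MinorCone

theorem sum_finset_four (f : Finset (Fin 4) → ℝ) :
    ∑ T, f T = f ∅ + f {0} + f {1} + f {2} + f {3} + f {0, 1} + f {0, 2} + f {0, 3} + f {1, 2} +
      f {1, 3} + f {2, 3} + f {0, 1, 2} + f {0, 1, 3} + f {0, 2, 3} + f {1, 2, 3} +
      f {0, 1, 2, 3} := by
  have h : (Finset.univ : Finset (Finset (Fin 4))) = List.toFinset [∅, {0}, {1}, {2}, {3}, {0, 1},
      {0, 2}, {0, 3}, {1, 2}, {1, 3}, {2, 3}, {0, 1, 2}, {0, 1, 3}, {0, 2, 3}, {1, 2, 3},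
      {0, 1, 2, 3}] := by decide
  rw [h, List.sum_toFinset _ (by decide)]
  simp only [List.map_cons, List.map_nil, List.sum_cons, List.sum_nil]
  ring

/-- The sums of the entries of `x` over the supersets of the sets with at least two elements, indexed
by binary codes. -/
def upperSums (x : Finset (Fin 4) → ℝ) (m : ℕ) : ℝ :=
  if m ∈ largeCodes then ∑ T, if codeSet m ⊆ T then x T else 0 else 0

theorem upperSums_apply (x : Finset (Fin 4) → ℝ) :
    upperSums x 3 = x {0, 1} + x {0, 1, 2} + x {0, 1, 3} + x {0, 1, 2, 3} ∧
    upperSums x 5 = x {0, 2} + x {0, 1, 2} + x {0, 2, 3} + x {0, 1, 2, 3} ∧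
    upperSums x 9 = x {0, 3} + x {0, 1, 3} + x {0, 2, 3} + x {0, 1, 2, 3} ∧
    upperSums x 6 = x {1, 2} + x {0, 1, 2} + x {1, 2, 3} + x {0, 1, 2, 3} ∧
    upperSums x 10 = x {1, 3} + x {0, 1, 3} + x {1, 2, 3} + x {0, 1, 2, 3} ∧
    upperSums x 12 = x {2, 3} + x {0, 2, 3} + x {1, 2, 3} + x {0, 1, 2, 3} ∧
    upperSums x 7 = x {0, 1, 2} + x {0, 1, 2, 3} ∧ upperSums x 11 = x {0, 1, 3} + x {0, 1, 2, 3} ∧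
    upperSums x 13 = x {0, 2, 3} + x {0, 1, 2, 3} ∧ upperSums x 14 = x {1, 2, 3} + x {0, 1, 2, 3} ∧
    upperSums x 15 = x {0, 1, 2, 3} := by
  simp +decide only [upperSums, sum_finset_four, if_true, if_false, zero_add, add_zero, true_and]

/-- Möbius inversion, `h T = ∑ S ⊆ T, moebius h S`, and exchange of summations. Singletons drop out
by homogeneity and the empty set by `h ∅ = 0`. -/
theorem pairing_upperSums {x h : Finset (Fin 4) → ℝ} (hx : ∀ i, ∑ T with i ∈ T, x T = 0)
    (h0 : h ∅ = 0) : pairing h (upperSums x) = ∑ T, x T * h T := by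
  obtain ⟨v3, v5, v9, v6, v10, v12, v7, v11, v13, v14, v15⟩ := upperSums_apply x
  have x0 := hx 0
  have x1 := hx 1
  have x2 := hx 2
  have x3 := hx 3
  simp only [Finset.sum_filter, sum_finset_four] at x0 x1 x2 x3
  simp +decide only [if_true, if_false, zero_add, add_zero] at x0 x1 x2 x3
  have c3 : codeSet 3 = {0, 1} := by decide
  have c5 : codeSet 5 = {0, 2} := by decide
  have c9 : codeSet 9 = {0, 3} := by decide
  have c6 : codeSet 6 = {1, 2} := by decide
  have c10 : codeSet 10 = {1, 3} := by decide
  have c12 : codeSet 12 = {2, 3} := by decide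
  have c7 : codeSet 7 = {0, 1, 2} := by decide
  have c11 : codeSet 11 = {0, 1, 3} := by decide
  have c13 : codeSet 13 = {0, 2, 3} := by decide
  have c14 : codeSet 14 = {1, 2, 3} := by decide
  have c15 : codeSet 15 = Finset.univ := by decide
  have hu : ({0, 1, 2, 3} : Finset (Fin 4)) = Finset.univ := by decide
  rw [hu] at x0 x1 x2 x3
  simp only [pairing, largeCodes, List.map_cons, List.map_nil, List.sum_cons, List.sum_nil,
    c3, c5, c9, c6, c10, c12, c7, c11, c13, c14, c15, v3, v5, v9, v6, v10, v12, v7, v11, v13, v14, v15,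
    moebius_pair h0 (show (0 : Fin 4) ≠ 1 by decide), moebius_pair h0 (show (0 : Fin 4) ≠ 2 by decide),
    moebius_pair h0 (show (0 : Fin 4) ≠ 3 by decide), moebius_pair h0 (show (1 : Fin 4) ≠ 2 by decide),
    moebius_pair h0 (show (1 : Fin 4) ≠ 3 by decide), moebius_pair h0 (show (2 : Fin 4) ≠ 3 by decide),
    moebius_triple h0 (show (0 : Fin 4) ≠ 1 by decide) (show (0 : Fin 4) ≠ 2 by decide)
      (show (1 : Fin 4) ≠ 2 by decide),
    moebius_triple h0 (show (0 : Fin 4) ≠ 1 by decide) (show (0 : Fin 4) ≠ 3 by decide)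
      (show (1 : Fin 4) ≠ 3 by decide),
    moebius_triple h0 (show (0 : Fin 4) ≠ 2 by decide) (show (0 : Fin 4) ≠ 3 by decide)
      (show (2 : Fin 4) ≠ 3 by decide),
    moebius_triple h0 (show (1 : Fin 4) ≠ 2 by decide) (show (1 : Fin 4) ≠ 3 by decide)
      (show (2 : Fin 4) ≠ 3 by decide),
    moebius_quadruple h0 (show [(0 : Fin 4), 1, 2, 3].Nodup by decide), sum_finset_four, h0, hu]
  linear_combination -(h {0}) * x0 - h {1} * x1 - h {2} * x2 - h {3} * x3

/-- A homogeneous exponent vector that satisfies the listed inequalities lies in the cone. -/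
theorem upperSums_mem_cone {x : Finset (Fin 4) → ℝ} (hx : ∀ i, ∑ T with i ∈ T, x T = 0)
    (hsum : ∑ T, x T = 0) (hN : ∀ N ∈ listedTables, 0 ≤ ∑ T, x T * (N T : ℝ)) :
    upperSums x ∈ cone permutedRays := by
  obtain ⟨v3, v5, v9, v6, v10, v12, v7, v11, v13, v14, v15⟩ := upperSums_apply x
  have x0 := hx 0
  have x1 := hx 1
  have x2 := hx 2
  have x3 := hx 3
  simp only [Finset.sum_filter, sum_finset_four] at x0 x1 x2 x3 hsum hN
  simp +decide only [if_true, if_false, zero_add, add_zero] at x0 x1 x2 x3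
  have row := fun S hS => hN _ (rowTable_mem_listedTables S hS)
  have three := fun X hX => hN _ (basisTable_three_mem_listedTables X hX)
  have two := fun X hX => hN _ (basisTable_two_mem_listedTables X hX)
  have uniform := hN _ uniformTable_mem_listedTables
  simp only [rowTable] at row
  simp only [basisTable] at three two
  have r := row ∅ (by decide)
  have r0 := row {0} (by decide)
  have r1 := row {1} (by decide)
  have r2 := row {2} (by decide)
  have r3 := row {3} (by decide)
  have r01 := row {0, 1} (by decide)
  have r02 := row {0, 2} (by decide)
  have r03 := row {0, 3} (by decide)
  have r12 := row {1, 2} (by decide)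
  have r13 := row {1, 3} (by decide)
  have r23 := row {2, 3} (by decide)
  have t012 := three {0, 1, 2} (by decide)
  have t013 := three {0, 1, 3} (by decide)
  have t023 := three {0, 2, 3} (by decide)
  have t123 := three {1, 2, 3} (by decide)
  have t0123 := three {0, 1, 2, 3} (by decide)
  have b01 := two {0, 1} (by decide)
  have b02 := two {0, 2} (by decide)
  have b03 := two {0, 3} (by decide)
  have b12 := two {1, 2} (by decide)
  have b13 := two {1, 3} (by decide)
  have b23 := two {2, 3} (by decide)
  clear row three two hN
  simp +decide at r r0 r1 r2 r3 r01 r02 r03 r12 r13 r23 t012 t013 t023 t123 t0123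
  simp +decide at b01 b02 b03 b12 b13 b23 uniform
  refine mem_cone_permutedRays (fun i hi => if_neg hi) ?_ ?_
  -- By homogeneity and zero total, the condition of `rowTable S` says that `x` has nonnegative sum
  -- over the subsets of `S`. By inclusion-exclusion, for a pair `S` this sum is the coordinate at
  -- the complementary pair. The tables `basisTable 3 X` give the coordinates at the triples and at
  -- the whole set.
  · simp only [largeCodes, List.mem_cons, List.not_mem_nil, or_false, forall_eq_or_imp, forall_eq,
      v3, v5, v9, v6, v10, v12, v7, v11, v13, v14, v15]
    refine ⟨?_, ?_, ?_, ?_, ?_, ?_, ?_, ?_, ?_, ?_, ?_⟩ <;> linarith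
  -- In order, these come from the six tables `basisTable 2 X`, the uniform table of rank two, the
  -- four `rowTable {i}`, and `rowTable ∅`.
  · simp only [inequalities, List.mem_cons, List.not_mem_nil, or_false, forall_eq_or_imp, forall_eq,
      Inequality.toLinear_apply, List.map_cons, List.map_nil, List.sum_cons, List.sum_nil,
      v3, v5, v9, v6, v10, v12, v7, v11, v13, v14, v15]
    refine ⟨?_, ?_, ?_, ?_, ?_, ?_, ?_, ?_, ?_, ?_, ?_, ?_⟩ <;> linarith

end MinorCone

/-! ### Sufficiency of the conditions and conclusion -/

theorem MinorRatio.mem_boundedRatios_of_nonneg {𝕜 : Type*} [RCLike 𝕜] {R : MinorRatio 4}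
    (hR : R ∈ homogeneousRatios 𝕜 4)
    (h : ∀ μ ∈ listedNullityTypes 𝕜, 0 ≤ subsetInner R.formalLog μ) : R ∈ boundedRatios 𝕜 4 := by
  rw [R.mem_homogeneousRatios_iff] at hR
  obtain ⟨C, hC⟩ := MinorCone.exists_pairing_le (Real.log 4)
    (MinorCone.upperSums_mem_cone hR R.sum_formalLog fun N hN => h _ (by
      rw [listedNullityTypes_eq]
      exact ⟨N, hN, rfl⟩))
  refine R.mem_boundedRatios_of_log_le (C := C) fun A hA => ?_
  rw [R.log_eval hA, ← MinorCone.pairing_upperSums hR (h := fun T => Real.log (principalMinor A T))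
    hA.logMinorLike.empty]
  exact hC _ hA.logMinorLike

theorem mainTheorem4 {𝕜 : Type*} [RCLike 𝕜] :
    (listedNullityTypes 𝕜).ncard = 23 ∧
    boundedRatios 𝕜 4 = dualNullityRatios 𝕜 4 ∧
    ∀ R ∈ homogeneousRatios 𝕜 4,
      (R ∈ boundedRatios 𝕜 4 ↔
        ∀ μ ∈ listedNullityTypes 𝕜, 0 ≤ subsetInner R.formalLog μ) := by
  have hlisted : ∀ R : MinorRatio 4,
      (∀ (m : ℕ) (M : Matrix (Fin m) (Fin 4) 𝕜), 0 ≤ subsetInner R.formalLog (nullityType M)) →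
        ∀ μ ∈ listedNullityTypes 𝕜, 0 ≤ subsetInner R.formalLog μ := by
    intro R hR μ hμ
    obtain ⟨m, M, rfl⟩ := exists_nullityType_of_mem_listedNullityTypes 𝕜 hμ
    exact hR m M
  refine ⟨ncard_listedNullityTypes 𝕜, Set.ext fun R => ⟨fun h => ?_, fun h => ?_⟩, fun R hR =>
    ⟨fun h => hlisted R fun m M => R.subsetInner_nullityType_nonneg h M, fun h =>
      MinorRatio.mem_boundedRatios_of_nonneg hR h⟩⟩
  · exact ⟨R.mem_homogeneousRatios_of_mem_boundedRatios h, fun m M =>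
      R.subsetInner_nullityType_nonneg h M⟩
  · exact MinorRatio.mem_boundedRatios_of_nonneg h.1 (hlisted R h.2)
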